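/- **Setting.** Dimensions are positive integers. For a map $f\colon[m]\to[n]$ let $\rho(f)\colon\mathbb R^n\to\mathbb R^m$, $(\rho(f)x)_i=x_{f(i)}$, and let $\rho(f)^\star$ be its adjoint. Let $\mathcal F$ be a construction built from the identity by Cartesian products, tensor products and symmetric powers $\mathrm{Sym}^k$ (symmetric tensors), and let $\mathbb V_n=\mathcal F(\mathbb R^n)$, with the induced maps $\rho(f),\rho(f)^\star$ (adjoint for the entrywise inner product) and the induced permutation action of $S_n$. The sequence $\mathcal F(\mathscr Z)$ consists of the spaces $\mathbb V_n$ with the embeddings $\mathbb V_n\to\mathbb V_N$ for $n\le N$ induced by zero-padding $x\mapsto(x,0)$, and $\mathcal F(\mathscr D)$ of the same spaces with the embeddings for $n\mid N$ induced by duplication $x\mapsto x\otimes\mathbf 1_{N/n}$. An FS-pair is $(\mathscr U,\mathscr L)=(\mathcal F(\mathscr Z),\mathcal F(\mathscr D))$ or $(\mathcal F(\mathscr D),\mathcal F(\mathscr Z))$; write $\varphi_{N,n}$, $\preceq_{\mathscr U}$ and $\psi_{N,n}$, $\preceq_{\mathscr L}$ for the embeddings and the orders of $\mathscr U$ and $\mathscr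 L$. Sets $\Omega_n\subseteq\mathbb V_n$ are FS-compatible if each $\Omega_n$ is $S_n$-invariant, $\varphi_{N,n}\Omega_n\subseteq\Omega_N$ for $n\preceq_{\mathscr U}N$, and $\psi_{N,n}^\star\Omega_N\subseteq\Omega_n$ for $n\preceq_{\mathscr L}N$. Fix $d\in\mathbb N$ and let $I_n=\mathbb R[\mathbb V_n]_{\le d}^{S_n}$ be the space of $S_n$-invariant polynomials of degree at most $d$. Let $\varprojlim_{\mathscr U}I_n$ be the space of sequences $(p_n)\in\prod_n I_n$ with $p_N\circ\varphi_{N,n}=p_n$ for $n\preceq_{\mathscr U}N$, with the projections $\pi_n\colon(p_m)\mapsto p_n$, and let $\varinjlim_{\mathscr L}I_n$ be the direct limit of the $I_n$ along the maps $q\mapsto\mathrm{sym}_{S_N}(q\circ\psi_{N,n}^\star)$, where $\mathrm{sym}_{S_N}$ is averaging over $S_N$, with the canonical maps $\varsigma_n\colon I_n\to\varinjlim_{\mathscr L}I_n$. Put $$\mathcal K_n=\{p\in I_n: p|_{\Omega_n}\ge0\},\qquad \varprojlim_{\mathscr U}\mathcal K_n=\{(p_n)\in\varprojlim_{\mathscr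 U}I_n: p_n|_{\Omega_n}\ge 0\ \forall n\},\qquad \varinjlim_{\mathscr L}\mathcal K_n=\{\varsigma_k(q_k): k\ge 1,\ q_k\in I_k,\ q_k|_{\Omega_k}\ge0\}.$$ For $x\in\mathbb V_n$ let $L_{k,n}x=\rho(F)x$ with $F\colon[k]\to[n]$ uniformly random if $\mathscr U=\mathcal F(\mathscr D)$, and $L_{k,n}x=\rho(F)^\star x$ with $F\colon[n]\to[k]$ uniformly random if $\mathscr U=\mathcal F(\mathscr Z)$. **Theorem.** Let $(\mathscr U,\mathscr L)$ be an FS-pair and $(\Omega_n)$ FS-compatible. Then $\varprojlim_{\mathscr U}I_n$ and $\varinjlim_{\mathscr L}I_n$ are finite-dimensional, and with respect to their unique Hausdorff vector space topologies the following hold. 1. (Density) There is a linear isomorphism $\varinjlim_{\mathscr L}I_n\to\varprojlim_{\mathscr U}I_n$ sending $\varsigma_k(q_k)$ to $(x\mapsto\mathbb E\,q_k(L_{k,n}x))_n$ for all $k$ and all $q_k\in I_k$, and it maps $\varinjlim_{\mathscr L}\mathcal K_n$ into a dense subset of $\varprojlim_{\mathscr U}\mathcal K_n$. 2. (Monotonicity)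 $\pi_N^{-1}(\mathcal K_N)\subseteq\pi_n^{-1}(\mathcal K_n)$ if $n\preceq_{\mathscr U}N$, and $\varsigma_n(\mathcal K_n)\subseteq\varsigma_N(\mathcal K_N)$ if $n\preceq_{\mathscr L}N$. Moreover $\varprojlim_{\mathscr U}\mathcal K_n=\bigcap_n\pi_n^{-1}(\mathcal K_n)$ and $\varinjlim_{\mathscr L}\mathcal K_n=\bigcup_n\varsigma_n(\mathcal K_n)$. 3. (Geometry) Both $\varprojlim_{\mathscr U}\mathcal K_n$ and $\varinjlim_{\mathscr L}\mathcal K_n$ are convex cones containing $0$, and the former is closed. The lineality space $K\cap(-K)$ consists of the elements that vanish on the sets: for $K=\varprojlim_{\mathscr U}\mathcal K_n$ it is the set of $(p_n)$ with $p_n|_{\Omega_n}=0$ for all $n$, and for $K=\varinjlim_{\mathscr L}\mathcal K_n$ it is the set of all $\varsigma_k(q_k)$ with $q_k\in I_k$ and $q_k|_{\Omega_k}=0$. In particular both cones are pointed ($K\cap(-K)=\{0\}$) if for every $n$ no nonzero element of $I_n$ vanishes identically on $\Omega_n$. Both cones have nonempty interior if $d$ is even or every $\Omega_n$ is bounded.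 -/

import Mathlib

open scoped BigOperators Pointwise

noncomputable section

namespace FreePoly

/-- Standard constructions, to be applied to the zero-padding sequence or to the duplication
sequence: the identity, Cartesian products, tensor products and symmetric powers. -/
inductive Construction : Type
  | id : Construction
  | prod : Construction → Construction → Construction
  | tensor : Construction → Construction → Construction
  | sym : ℕ → Construction → Construction

/-- Index set of the array entries: if the sequence starts from `ℝ^α`, then the space obtained by
`F` consists of arrays indexed by `Idx F α`. -/
def Idx : Construction → Type → Type
  | .id, α => α
  | .prod F G, α => Idx F α ⊕ Idx G α
  | .tensor F G, α => Idx F α × Idx G α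
  | .sym k F, α => Fin k → Idx F α

instance Idx.fintype : (F : Construction) → (α : Type) → [Fintype α] → Fintype (Idx F α)
  | .id, _, h => h
  | .prod F G, α, _ =>
    have := Idx.fintype F α
    have := Idx.fintype G α
    inferInstanceAs (Fintype (Idx F α ⊕ Idx G α))
  | .tensor F G, α, _ =>
    have := Idx.fintype F α
    have := Idx.fintype G α
    inferInstanceAs (Fintype (Idx F α × Idx G α))
  | .sym k F, α, _ =>
    have := Idx.fintype F α
    inferInstanceAs (Fintype (Fin k → Idx F α))

/-- The map of index sets induced by a map `f`. -/
def Idx.map : (F : Construction) → {α β : Type} → (α → β) → Idx F α → Idx F β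
  | .id, _, _, f => f
  | .prod F G, _, _, f => Sum.map (Idx.map F f) (Idx.map G f)
  | .tensor F G, _, _, f => Prod.map (Idx.map F f) (Idx.map G f)
  | .sym _ F, _, _, f => fun a i => Idx.map F f (a i)

/-- The vector space `F(ℝ^α)`, as a space of arrays: `ℝ^α` itself; the pairs of arrays for a
product; the span of the pure tensors `w ⊗ u` for a tensor product; the symmetric tensors in the
span of the pure tensors `w₁ ⊗ ⋯ ⊗ w_k` for a symmetric power. -/
def V : (F : Construction) → (α : Type) → Submodule ℝ (Idx F α → ℝ)
  | .id, _ => ⊤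
  | .prod F G, α =>
    { carrier := {X | (fun a => X (Sum.inl a)) ∈ V F α ∧ (fun b => X (Sum.inr b)) ∈ V G α}
      add_mem' := fun hX hY => ⟨(V F α).add_mem hX.1 hY.1, (V G α).add_mem hX.2 hY.2⟩
      zero_mem' := ⟨(V F α).zero_mem, (V G α).zero_mem⟩
      smul_mem' := fun c _ hX => ⟨(V F α).smul_mem c hX.1, (V G α).smul_mem c hX.2⟩ }
  | .tensor F G, α =>
    Submodule.span ℝ {X | ∃ w ∈ V F α, ∃ u ∈ V G α, X = fun ab => w ab.1 * u ab.2}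
  | .sym k F, α =>
    Submodule.span ℝ {X | ∃ w : Fin k → Idx F α → ℝ, (∀ i, w i ∈ V F α) ∧
      X = fun a => ∏ i, w i (a i)} ⊓
    { carrier := {X | ∀ (σ : Equiv.Perm (Fin k)) (a : Fin k → Idx F α), X (a ∘ σ) = X a}
      add_mem' := fun hX hY σ a => congrArg₂ (· + ·) (hX σ a) (hY σ a)
      zero_mem' := fun _ _ => rfl
      smul_mem' := fun c _ hX σ a => congrArg (c * ·) (hX σ a) }

/-- For `f : α → β`, the linear map `ρ(f) : ℝ^(Idx β) → ℝ^(Idx α)`, `(ρ(f) X)_a = X_{f(a)}`. -/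
def rho (F : Construction) {α β : Type} (f : α → β) : (Idx F β → ℝ) →ₗ[ℝ] (Idx F α → ℝ) :=
  LinearMap.funLeft ℝ ℝ (Idx.map F f)

open Classical in
/-- The adjoint `ρ(f)⋆` of `rho F f`: `(ρ(f)⋆ X)_b = ∑_{a : f(a) = b} X_a`. -/
def rhoAdj (F : Construction) {α β : Type} [Fintype α] (f : α → β) :
    (Idx F α → ℝ) →ₗ[ℝ] (Idx F β → ℝ) where
  toFun X b := ∑ a, if Idx.map F f a = b then X a else 0
  map_add' X Y := by
    funext b
    simp only [Pi.add_apply, ← Finset.sum_add_distrib]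
    refine Finset.sum_congr rfl fun a _ => ?_
    split_ifs <;> simp
  map_smul' c X := by
    funext b
    simp only [Pi.smul_apply, smul_eq_mul, Finset.mul_sum, RingHom.id_apply]
    refine Finset.sum_congr rfl fun a _ => ?_
    split_ifs <;> simp

/-- `rhoAdj` is the adjoint of `rho` for the standard (entrywise) inner product. -/
theorem rhoAdj_adjoint (F : Construction) {α β : Type} [Fintype α] [Fintype β] (f : α → β)
    (X : Idx F α → ℝ) (Y : Idx F β → ℝ) :
    ∑ b, rhoAdj F f X b * Y b = ∑ a, X a * rho F f Y a := by
  classical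
  simp only [rhoAdj, LinearMap.coe_mk, AddHom.coe_mk, rho, LinearMap.funLeft_apply,
    Finset.sum_mul]
  rw [Finset.sum_comm]
  refine Finset.sum_congr rfl fun a _ => ?_
  simp

theorem rho_mem : (F : Construction) → {α β : Type} → (f : α → β) →
    ∀ X ∈ V F β, rho F f X ∈ V F α
  | .id, _, _, _ => fun _ _ => trivial
  | .prod F G, _, _, f => fun _ hX => ⟨rho_mem F f _ hX.1, rho_mem G f _ hX.2⟩
  | .tensor F G, _, _, f => fun X hX => by
    refine Submodule.span_le (p := (Submodule.span ℝ _).comap (rho (.tensor F G) f)).2 ?_ hX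
    rintro _ ⟨w, hw, u, hu, rfl⟩
    exact Submodule.subset_span ⟨_, rho_mem F f w hw, _, rho_mem G f u hu, rfl⟩
  | .sym k F, _, _, f => fun X hX => by
    refine ⟨?_, fun σ a => hX.2 σ (fun i => Idx.map F f (a i))⟩
    refine Submodule.span_le (p := (Submodule.span ℝ _).comap (rho (.sym k F) f)).2 ?_ hX.1
    rintro _ ⟨w, hw, rfl⟩
    exact Submodule.subset_span ⟨_, fun i => rho_mem F f (w i) (hw i), rfl⟩

theorem rhoAdj_mem : (F : Construction) → {α β : Type} → [Fintype α] → (f : α → β) →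
    ∀ X ∈ V F α, rhoAdj F f X ∈ V F β
  | .id, _, _, _, _ => fun _ _ => trivial
  | .prod F G, _, _, _, f => fun X hX => by
    classical
    refine ⟨?_, ?_⟩
    · convert rhoAdj_mem F f _ hX.1 using 1
      funext b
      refine (Fintype.sum_sum_type _).trans ?_
      simp only [rhoAdj, Idx.map, Sum.map_inl, Sum.map_inr, reduceCtorEq,
        if_false, Finset.sum_const_zero, add_zero, LinearMap.coe_mk, AddHom.coe_mk]
      exact Finset.sum_congr rfl fun a _ => if_congr Sum.inl_injective.eq_iff rfl rfl
    · convert rhoAdj_mem G f _ hX.2 using 1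
      funext b
      refine (Fintype.sum_sum_type _).trans ?_
      simp only [rhoAdj, Idx.map, Sum.map_inl, Sum.map_inr, reduceCtorEq,
        if_false, Finset.sum_const_zero, zero_add, LinearMap.coe_mk, AddHom.coe_mk]
      exact Finset.sum_congr rfl fun a _ => if_congr Sum.inr_injective.eq_iff rfl rfl
  | .tensor F G, _, _, _, f => fun X hX => by
    classical
    refine Submodule.span_le (p := (Submodule.span ℝ _).comap (rhoAdj (.tensor F G) f)).2 ?_ hX
    rintro _ ⟨w, hw, u, hu, rfl⟩
    refine Submodule.subset_span ⟨_, rhoAdj_mem F f w hw, _, rhoAdj_mem G f u hu, ?_⟩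
    funext b
    simp only [rhoAdj, LinearMap.coe_mk, AddHom.coe_mk, Finset.sum_mul_sum]
    refine (Fintype.sum_prod_type _).trans ?_
    refine Finset.sum_congr rfl fun a _ => Finset.sum_congr rfl fun c _ => ?_
    rw [ite_zero_mul_ite_zero]
    exact if_congr Prod.ext_iff rfl rfl
  | .sym k F, _, _, _, f => fun X hX => by
    classical
    refine ⟨?_, fun σ b => ?_⟩
    · refine Submodule.span_le
        (p := (Submodule.span ℝ _).comap (rhoAdj (.sym k F) f)).2 ?_ hX.1
      rintro _ ⟨w, hw, rfl⟩
      refine Submodule.subset_span ⟨_, fun i => rhoAdj_mem F f (w i) (hw i), ?_⟩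
      funext b
      simp only [rhoAdj, LinearMap.coe_mk, AddHom.coe_mk]
      rw [Finset.prod_univ_sum, Fintype.piFinset_univ]
      refine Finset.sum_congr rfl fun a _ => ?_
      rw [Finset.prod_ite_zero]
      have hab : Idx.map (.sym k F) f a = b ↔ ∀ i ∈ Finset.univ, Idx.map F f (a i) = b i :=
        funext_iff.trans (by simp [Idx.map])
      by_cases h : Idx.map (.sym k F) f a = b
      · rw [if_pos h, if_pos (hab.1 h)]
      · rw [if_neg h, if_neg (fun h' => h (hab.2 h'))]
    · change (∑ a, if Idx.map (.sym k F) f a = b ∘ σ then X a else 0) =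
        ∑ a, if Idx.map (.sym k F) f a = b then X a else 0
      refine (Fintype.sum_equiv (Equiv.arrowCongr σ (Equiv.refl (Idx F _))) _ _ ?_)
      intro a
      have h1 : X (a ∘ σ.symm) = X a := hX.2 σ.symm a
      have h2 : (Idx.map (.sym k F) f (a ∘ σ.symm) = b) ↔
          (Idx.map (.sym k F) f a = b ∘ σ) := by
        refine ⟨fun h => funext fun i => ?_, fun h => funext fun i => ?_⟩
        · simpa [Idx.map] using congrFun h (σ i)
        · simpa [Idx.map] using congrFun h (σ.symm i)
      change _ = if Idx.map (.sym k F) f (a ∘ σ.symm) = b then X (a ∘ σ.symm) else 0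
      rw [h1]
      exact if_congr h2.symm rfl rfl

/-- The action `ρ(f) : F(ℝ^β) → F(ℝ^α)` of a map `f : α → β`. -/
def pull (F : Construction) {α β : Type} (f : α → β) : V F β →ₗ[ℝ] V F α :=
  (rho F f).restrict (rho_mem F f)

/-- The adjoint action `ρ(f)⋆ : F(ℝ^α) → F(ℝ^β)` of a map `f : α → β`. -/
def push (F : Construction) {α β : Type} [Fintype α] (f : α → β) : V F α →ₗ[ℝ] V F β :=
  (rhoAdj F f).restrict (rhoAdj_mem F f)

/-- The two basic consistent sequences: zero-padding and duplication. -/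
inductive Kind : Type
  | zeroPad : Kind
  | dup : Kind

/-- The other one of the two. -/
def Kind.other : Kind → Kind
  | .zeroPad => .dup
  | .dup => .zeroPad

/-- The partial order on the dimensions: `n ≤ N` for zero-padding, `n ∣ N` for duplication. -/
def Kind.le : Kind → ℕ+ → ℕ+ → Prop
  | .zeroPad, n, N => n ≤ N
  | .dup, n, N => n ∣ N

/-- The equipartition `[N] → [n]` for `n ∣ N`, constant on consecutive blocks of length `N / n`. -/
def equipart {n N : ℕ+} (h : n ∣ N) (j : Fin N) : Fin n :=
  ⟨j / ((N : ℕ) / n), Nat.div_lt_of_lt_mul (by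
    rw [Nat.div_mul_cancel (PNat.dvd_iff.1 h)]; exact j.2)⟩

/-- The inclusion `[n] → [N]` for `n ≤ N`. -/
def incl {n N : ℕ+} (h : n ≤ N) : Fin n → Fin N := Fin.castLE h

/-- The space in dimension `n` of the sequences `F(𝒵)` and `F(𝒟)`. -/
abbrev Space (F : Construction) (n : ℕ+) : Type := V F (Fin n)

/-- The action of `σ ∈ S_n`; on `ℝ^n` it is `(σ · x)_i = x_{σ⁻¹ i}`. -/
def act (F : Construction) {n : ℕ+} (σ : Equiv.Perm (Fin n)) : Space F n →ₗ[ℝ] Space F n :=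
  pull F ⇑(σ⁻¹)

/-- The embedding `F(ℝ^n) → F(ℝ^N)` in `F(𝒵)` (by zero-padding) or in `F(𝒟)` (by duplication). -/
def emb (F : Construction) : (κ : Kind) → {n N : ℕ+} → κ.le n N → (Space F n →ₗ[ℝ] Space F N)
  | .zeroPad, _, _, h => push F (incl h)
  | .dup, _, _, h => pull F (equipart h)

/-- The adjoint of the embedding. -/
def embAdj (F : Construction) : (κ : Kind) → {n N : ℕ+} → κ.le n N → (Space F N →ₗ[ℝ] Space F n)
  | .zeroPad, _, _, h => pull F (incl h)
  | .dup, _, _, h => push F (equipart h)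

/-- The polynomial functions on `F(ℝ^n)` of degree at most `d`. -/
def Poly (F : Construction) (d : ℕ) (n : ℕ+) : Submodule ℝ (Space F n → ℝ) where
  carrier := {p | ∃ P : MvPolynomial (Idx F (Fin n)) ℝ, P.totalDegree ≤ d ∧
    ∀ x : Space F n, p x = MvPolynomial.eval x.1 P}
  add_mem' := by
    rintro p q ⟨P, hP, hp⟩ ⟨Q, hQ, hq⟩
    exact ⟨P + Q, (MvPolynomial.totalDegree_add P Q).trans (max_le hP hQ),
      fun x => by simp [hp, hq]⟩
  zero_mem' := ⟨0, by simp, fun x => by simp⟩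
  smul_mem' := by
    rintro c p ⟨P, hP, hp⟩
    exact ⟨c • P, (MvPolynomial.totalDegree_smul_le c P).trans hP, fun x => by simp [hp]⟩

/-- The `S_n`-invariant polynomials of degree at most `d` on `F(ℝ^n)`. -/
def Inv (F : Construction) (d : ℕ) (n : ℕ+) : Submodule ℝ (Space F n → ℝ) where
  carrier := {p | p ∈ Poly F d n ∧ ∀ (σ : Equiv.Perm (Fin n)) (x : Space F n),
    p (act F σ x) = p x}
  add_mem' := fun hp hq => ⟨(Poly F d n).add_mem hp.1 hq.1,
    fun σ x => congrArg₂ (· + ·) (hp.2 σ x) (hq.2 σ x)⟩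
  zero_mem' := ⟨(Poly F d n).zero_mem, fun _ _ => rfl⟩
  smul_mem' := fun c _ hp => ⟨(Poly F d n).smul_mem c hp.1,
    fun σ x => congrArg (c * ·) (hp.2 σ x)⟩

theorem poly_comp_pull {F : Construction} {d : ℕ} {n N : ℕ+} (f : Fin n → Fin N)
    {p : Space F n → ℝ} (hp : p ∈ Poly F d n) : (fun x => p (pull F f x)) ∈ Poly F d N := by
  obtain ⟨P, hP, hp⟩ := hp
  refine ⟨MvPolynomial.rename (Idx.map F f) P,
    (MvPolynomial.totalDegree_rename_le _ _).trans hP, fun x => ?_⟩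
  refine (hp _).trans ?_
  rw [MvPolynomial.eval_rename]
  rfl

theorem poly_comp_push {F : Construction} {d : ℕ} {n N : ℕ+} (f : Fin N → Fin n)
    {p : Space F n → ℝ} (hp : p ∈ Poly F d n) : (fun x => p (push F f x)) ∈ Poly F d N := by
  classical
  obtain ⟨P, hP, hp⟩ := hp
  let ℓ : Idx F (Fin n) → MvPolynomial (Idx F (Fin N)) ℝ := fun b =>
    ∑ a, if Idx.map F f a = b then MvPolynomial.X a else 0
  have hℓ : ∀ b, (ℓ b).totalDegree ≤ 1 := fun b =>
    MvPolynomial.totalDegree_finsetSum_le fun a _ => by split_ifs <;> simp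
  refine ⟨MvPolynomial.bind₁ ℓ P, ?_, fun x => ?_⟩
  · rw [P.as_sum, map_sum]
    refine MvPolynomial.totalDegree_finsetSum_le fun m hm => ?_
    rw [MvPolynomial.bind₁_monomial]
    refine (MvPolynomial.totalDegree_mul _ _).trans ?_
    rw [MvPolynomial.totalDegree_C, zero_add]
    refine (MvPolynomial.totalDegree_finsetProd _ _).trans ?_
    refine le_trans (Finset.sum_le_sum fun b _ => ?_)
      ((MvPolynomial.le_totalDegree hm).trans hP)
    refine (MvPolynomial.totalDegree_pow _ _).trans ?_
    exact (Nat.mul_le_mul_left _ (hℓ b)).trans (mul_one _).le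
  · refine (hp _).trans ?_
    rw [← MvPolynomial.coe_aeval_eq_eval, ← MvPolynomial.coe_aeval_eq_eval]
    change _ = MvPolynomial.aeval x.1 (MvPolynomial.bind₁ ℓ P)
    rw [MvPolynomial.aeval_bind₁]
    change MvPolynomial.aeval _ P = _
    congr 2
    funext b
    simp only [ℓ, map_sum]
    refine Finset.sum_congr rfl fun a _ => ?_
    split_ifs <;> simp

theorem poly_comp_embAdj {F : Construction} {d : ℕ} : (κ : Kind) → {n N : ℕ+} →
    (h : κ.le n N) → {p : Space F n → ℝ} → p ∈ Poly F d n →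
    (fun x => p (embAdj F κ h x)) ∈ Poly F d N
  | .zeroPad, _, _, h, _, hp => poly_comp_pull (incl h) hp
  | .dup, _, _, h, _, hp => poly_comp_push (equipart h) hp

theorem act_mul {F : Construction} {n : ℕ+} (σ τ : Equiv.Perm (Fin n)) (x : Space F n) :
    act F σ (act F τ x) = act F (σ * τ) x := by
  have key : ∀ (F : Construction) {α β γ : Type} (f : α → β) (g : β → γ) (a : Idx F α),
      Idx.map F g (Idx.map F f a) = Idx.map F (g ∘ f) a := by
    intro F
    induction F with
    | id => intros; rfl
    | prod F G hF hG =>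
      rintro _ _ _ f g (a | a)
      · exact congrArg Sum.inl (hF f g a)
      · exact congrArg Sum.inr (hG f g a)
    | tensor F G hF hG => intro _ _ _ f g a; exact Prod.ext (hF f g a.1) (hG f g a.2)
    | sym k F hF => intro _ _ _ f g a; exact funext fun i => hF f g (a i)
  refine Subtype.ext (funext fun a => ?_)
  change x.1 (Idx.map F _ (Idx.map F _ a)) = x.1 (Idx.map F _ a)
  rw [key, mul_inv_rev]
  rfl

/-- The map `q ↦ sym_{S_N} (q ∘ φ⋆)`, where `φ⋆` is the adjoint of the embedding from dimension
`n` to dimension `N`, between the spaces of invariant polynomials. -/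
def symMap (F : Construction) (d : ℕ) (κ : Kind) {n N : ℕ+} (h : κ.le n N) :
    Inv F d n →ₗ[ℝ] Inv F d N where
  toFun q := ⟨fun x => (Fintype.card (Equiv.Perm (Fin N)) : ℝ)⁻¹ *
      ∑ σ : Equiv.Perm (Fin N), q.1 (embAdj F κ h (act F σ x)), by
    refine ⟨?_, fun τ x => ?_⟩
    · have h1 : (fun x => (Fintype.card (Equiv.Perm (Fin N)) : ℝ)⁻¹ *
          ∑ σ : Equiv.Perm (Fin N), q.1 (embAdj F κ h (act F σ x))) =
          (Fintype.card (Equiv.Perm (Fin N)) : ℝ)⁻¹ •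
            ∑ σ : Equiv.Perm (Fin N), fun x => q.1 (embAdj F κ h (act F σ x)) := by
        funext x
        simp [Finset.sum_apply]
      rw [h1]
      exact Submodule.smul_mem _ _ (Submodule.sum_mem _ fun σ _ =>
        poly_comp_pull _ (poly_comp_embAdj κ h q.2.1))
    · refine congrArg _ ?_
      refine Fintype.sum_equiv (Equiv.mulRight τ) _ _ fun σ => ?_
      rw [act_mul]
      rfl⟩
  map_add' p q := Subtype.ext (funext fun x => by
    simp [Finset.sum_add_distrib, mul_add])
  map_smul' c q := Subtype.ext (funext fun x => by
    simp only [Submodule.coe_smul, Pi.smul_apply, smul_eq_mul, ← Finset.mul_sum,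
      RingHom.id_apply]
    ring)

/-- The freely-described polynomials of degree at most `d` over `F(𝒵)` or `F(𝒟)`: the sequences of
invariant polynomials `(p_n)` with `p_N ∘ φ_{N,n} = p_n`. It carries the topology of pointwise
convergence. -/
def FreelyDescribed (F : Construction) (d : ℕ) (κ : Kind) :
    Submodule ℝ (∀ n : ℕ+, Inv F d n) where
  carrier := {p | ∀ (n N : ℕ+) (h : κ.le n N) (x : Space F n), (p N).1 (emb F κ h x) = (p n).1 x}
  add_mem' := fun hp hq n N h x => congrArg₂ (· + ·) (hp n N h x) (hq n N h x)
  zero_mem' := fun _ _ _ _ => rfl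
  smul_mem' := fun c _ hp n N h x => congrArg (c * ·) (hp n N h x)

/-- The projection `(p_n) ↦ p_n`. -/
def proj (F : Construction) (d : ℕ) (κ : Kind) (n : ℕ+) :
    FreelyDescribed F d κ →ₗ[ℝ] Inv F d n :=
  (LinearMap.proj n).comp (FreelyDescribed F d κ).subtype

/-- The dimensions `n`, with the order of `κ`. -/
structure Level (κ : Kind) : Type where
  dim : ℕ+

instance (κ : Kind) : DecidableEq (Level κ) := fun a b =>
  decidable_of_iff (a.dim = b.dim) ⟨fun h => by cases a; cases b; exact congrArg _ h, congrArg _⟩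

instance (κ : Kind) : Preorder (Level κ) where
  le a b := κ.le a.dim b.dim
  le_refl a := by cases κ; exacts [le_refl a.dim, dvd_refl a.dim]
  le_trans a b c hab hbc := by
    cases κ
    exacts [le_trans (α := ℕ+) hab hbc, dvd_trans (α := ℕ+) hab hbc]

/-- The freely-symmetrized polynomials of degree at most `d` over `F(𝒵)` or `F(𝒟)`: the direct
limit of the spaces of invariant polynomials along the maps `symMap`. -/
abbrev FreelySymmetrized (F : Construction) (d : ℕ) (κ : Kind) : Type :=
  Module.DirectLimit (R := ℝ) (ι := Level κ) (fun n => Inv F d n.dim) (fun _ _ h => symMap F d κ h)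

/-- The finest topology making it a topological vector space; on a finite-dimensional space this is
the unique Hausdorff one. -/
instance (F : Construction) (d : ℕ) (κ : Kind) : TopologicalSpace (FreelySymmetrized F d κ) :=
  moduleTopology ℝ _

/-- The map sending an invariant polynomial to its class in the direct limit. -/
def toLim (F : Construction) (d : ℕ) (κ : Kind) (n : ℕ+) :
    Inv F d n →ₗ[ℝ] FreelySymmetrized F d κ :=
  Module.DirectLimit.of ℝ (Level κ) (fun n => Inv F d n.dim) (fun _ _ h => symMap F d κ h) ⟨n⟩

/-- The expectation `𝔼 q(L_{k,n} x)`, where `L_{k,n}` is the random de Finetti map of the pair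
`(𝒰, ℒ)`, with `𝒰` of kind `κ`: it is `ρ(f)` for a uniformly random `f : [k] → [n]` if
`𝒰 = F(𝒟)`, and `ρ(f)⋆` for a uniformly random `f : [n] → [k]` if `𝒰 = F(𝒵)`. -/
def deFinettiMean (F : Construction) : (κ : Kind) → {k : ℕ+} → (Space F k → ℝ) →
    (n : ℕ+) → Space F n → ℝ
  | .dup, k, q, n, x =>
    (Fintype.card (Fin k → Fin n) : ℝ)⁻¹ * ∑ f : Fin k → Fin n, q (pull F f x)
  | .zeroPad, k, q, n, x =>
    (Fintype.card (Fin n → Fin k) : ℝ)⁻¹ * ∑ f : Fin n → Fin k, q (push F f x)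

/-- FS-compatibility of the sets `Ω_n` with the pair `(𝒰, ℒ)` in which `𝒰` is the sequence of kind
`κ` obtained by `F`, and `ℒ` is the one of the other kind. -/
structure FSCompatible (F : Construction) (κ : Kind) (Ω : ∀ n : ℕ+, Set (Space F n)) : Prop where
  act_mem : ∀ (n : ℕ+) (σ : Equiv.Perm (Fin n)), ∀ x ∈ Ω n, act F σ x ∈ Ω n
  emb_mem : ∀ (n N : ℕ+) (h : κ.le n N), ∀ x ∈ Ω n, emb F κ h x ∈ Ω N
  embAdj_mem : ∀ (n N : ℕ+) (h : κ.other.le n N), ∀ x ∈ Ω N, embAdj F κ.other h x ∈ Ω n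

/-- The invariant polynomials that are nonnegative on `Ω_n`. -/
def nonnegCone {F : Construction} (d : ℕ) (Ω : ∀ n : ℕ+, Set (Space F n)) (n : ℕ+) :
    Set (Inv F d n) :=
  {p | ∀ x ∈ Ω n, 0 ≤ p.1 x}

/-- The freely-described polynomials that are nonnegative on every `Ω_n`. -/
def describedCone {F : Construction} (d : ℕ) (κ : Kind) (Ω : ∀ n : ℕ+, Set (Space F n)) :
    Set (FreelyDescribed F d κ) :=
  {p | ∀ n : ℕ+, ∀ x ∈ Ω n, 0 ≤ (p.1 n).1 x}

/-- The freely-symmetrized polynomials that are represented by some `q_k` nonnegative on `Ω_k`. -/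
def symmetrizedCone {F : Construction} (d : ℕ) (κ : Kind) (Ω : ∀ n : ℕ+, Set (Space F n)) :
    Set (FreelySymmetrized F d κ) :=
  {u | ∃ (k : ℕ+) (q : Inv F d k), (∀ x ∈ Ω k, 0 ≤ q.1 x) ∧ u = toLim F d κ k q}

end FreePoly

end

/-!
Write `[n]` for `Fin n`, and let `κ` be the kind of the sequence `𝒰`. Everything is expressed through
the maps `ρ(f)` and `ρ(f)⋆` for arbitrary maps `f` of finite sets: the embeddings, their adjoints, the
action of the symmetric groups and the random maps `L_{k,n}` are all of this form, and they compose
functorially. Averages over permutations and over random maps are compared with the help of two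
facts: any two injections `[n] → [N]`, and likewise any two maps `[N] → [n]` with fibres of equal
size, differ by a permutation of `[N]`.

*Stabilization.* A monomial of degree at most `d` involves at most `d * arity F` elements of `[n]`, its
labels. Finite differences of higher order therefore vanish, and a polynomial lies in the span of
its restrictions to arrays with at most `d * arity F + 1` labels (`mem_of_forall_comp_push_pull`).
Consequently, in large dimensions, restriction along zero-padding is injective on invariant
polynomials (`restr_injective`), and the symmetrization maps for zero-padding are surjective
(`symMap_zeroPad_surjective`). So the dimension of the space of invariant polynomials does not
increase and is eventually a constant `r`. Both limits have dimension at most `r` for either kind,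
and those over zero-padding have dimension exactly `r`.

*Isomorphism and density.* The map `q ↦ (x ↦ 𝔼 q(L_{k,n} x))_n` induces a map `limMap` on the direct
limit. A uniformly random map `[k] → [n]` is injective with probability tending to one, and every map
`[k] → [n]` with `k ≤ n` is an injection after a self-map of `[k]`, so that averages over these maps
converge (`tendsto_average_of_injective`). If `𝒰` is given by zero-padding, this shows that the images of
the terms `p_n` converge to `(p_n)`; the range of `limMap` is closed, so it is everything, and `limMap`
is bijective because the dimension of its target is `r`. If `𝒰` is given by duplication, the same
argument in the direct limit shows that the terms of the image of `q` converge to the class of `q`;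
so `limMap` is injective, and bijective because the dimension of its source is `r`. In both cases
`limMap (p_n)` converges to `(p_n)` (`tendsto_limMap_toLim`), which is the density statement: every map
`[k] → [n]` factors into an embedding, a permutation and an equipartition, so compatibility of the sets
makes `limMap` preserve nonnegativity.

*Geometry.* If `u` and `-u` both lie in the cone of the direct limit, they are represented in one common
dimension by nonnegative polynomials with sum zero. The cone of the direct limit generates the space,
because `q = (q + g) - g`, where `g` is a multiple of `(1 + ‖x‖²)^(d/2)`, or of `1` for bounded sets. A
generating convex cone in a finite-dimensional space has interior points, and `limMap` carries them
to the cone of the inverse limit.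
-/

open scoped BigOperators Pointwise

noncomputable section

namespace FreePoly

/-! ### Functoriality of the constructions -/

theorem Idx.map_map (F : Construction) {α β γ : Type} (f : α → β) (g : β → γ) (a : Idx F α) :
    Idx.map F g (Idx.map F f a) = Idx.map F (g ∘ f) a := by
  induction F with
  | id => rfl
  | prod F G hF hG =>
    rcases a with a | a
    · exact congrArg Sum.inl (hF a)
    · exact congrArg Sum.inr (hG a)
  | tensor F G hF hG => exact Prod.ext (hF a.1) (hG a.2)
  | sym k F hF => exact funext fun i => hF (a i)

theorem Idx.map_id (F : Construction) {α : Type} (a : Idx F α) : Idx.map F _root_.id a = a := by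
  induction F with
  | id => rfl
  | prod F G hF hG =>
    rcases a with a | a
    · exact congrArg Sum.inl (hF a)
    · exact congrArg Sum.inr (hG a)
  | tensor F G hF hG => exact Prod.ext (hF a.1) (hG a.2)
  | sym k F hF => exact funext fun i => hF (a i)

theorem Idx.map_injective (F : Construction) {α β : Type} {f : α → β} (hf : f.Injective) :
    (Idx.map F f).Injective := by
  induction F with
  | id => exact hf
  | prod F G hF hG => exact hF.sumMap hG
  | tensor F G hF hG => exact hF.prodMap hG
  | sym k F hF => exact fun a b h => funext fun i => hF (congrFun h i)

theorem pull_pull (F : Construction) {α β γ : Type} (f : α → β) (g : β → γ) (x : V F γ) :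
    pull F f (pull F g x) = pull F (g ∘ f) x := by
  refine Subtype.ext (funext fun a => ?_)
  change x.1 (Idx.map F g (Idx.map F f a)) = x.1 (Idx.map F _ a)
  rw [Idx.map_map]

theorem pull_id (F : Construction) {α : Type} (x : V F α) : pull F _root_.id x = x := by
  refine Subtype.ext (funext fun a => ?_)
  change x.1 (Idx.map F _ a) = x.1 a
  rw [Idx.map_id]

open Classical in
theorem push_apply (F : Construction) {α β : Type} [Fintype α] (f : α → β) (x : V F α)
    (b : Idx F β) : (push F f x).1 b = ∑ a, if Idx.map F f a = b then x.1 a else 0 := rfl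

theorem push_push (F : Construction) {α β γ : Type} [Fintype α] [Fintype β] (f : α → β)
    (g : β → γ) (x : V F α) : push F g (push F f x) = push F (g ∘ f) x := by
  classical
  refine Subtype.ext (funext fun c => ?_)
  have h1 : (push F g (push F f x)).1 c =
      ∑ b, ∑ a, if Idx.map F f a = b then (if Idx.map F g b = c then x.1 a else 0) else 0 := by
    rw [push_apply]
    refine Finset.sum_congr rfl fun b _ => ?_
    rw [push_apply]
    split_ifs <;> simp
  rw [h1, Finset.sum_comm, push_apply]
  refine Finset.sum_congr rfl fun a _ => ?_
  rw [Finset.sum_ite_eq, if_pos (Finset.mem_univ _), Idx.map_map]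

theorem push_id (F : Construction) {α : Type} [Fintype α] (x : V F α) :
    push F _root_.id x = x := by
  classical
  refine Subtype.ext (funext fun a => ?_)
  simp [push_apply, Idx.map_id]

theorem push_apply_map (F : Construction) {α β : Type} [Fintype α] {f : α → β}
    (hf : f.Injective) (x : V F α) (a : Idx F α) :
    (push F f x).1 (Idx.map F f a) = x.1 a := by
  classical
  simp [push_apply, (Idx.map_injective F hf).eq_iff]

theorem push_apply_of_notMem (F : Construction) {α β : Type} [Fintype α] (f : α → β)
    (x : V F α) {b : Idx F β} (hb : b ∉ Set.range (Idx.map F f)) : (push F f x).1 b = 0 := by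
  classical
  rw [push_apply]
  exact Finset.sum_eq_zero fun a _ => if_neg fun h => hb ⟨a, h⟩

theorem act_eq_pull (F : Construction) {n : ℕ+} (σ : Equiv.Perm (Fin n)) (x : Space F n) :
    act F σ x = pull F (σ.symm) x := rfl

theorem act_eq_push (F : Construction) {n : ℕ+} (σ : Equiv.Perm (Fin n)) (x : Space F n) :
    act F σ x = push F σ x := by
  rw [act_eq_pull]
  conv_lhs => rw [← push_id F x, ← σ.symm_comp_self, ← push_push]
  refine Subtype.ext (funext fun b => ?_)
  change (push F σ.symm (push F σ x)).1 (Idx.map F σ.symm b) = _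
  rw [push_apply_map F σ.symm.injective]

/-! ### Labels -/

/-- The elements of `α` on which an index depends. -/
def labels : (F : Construction) → {α : Type} → [DecidableEq α] → Idx F α → Finset α
  | .id, _, _, a => {a}
  | .prod F G, _, _, a => Sum.elim (labels F) (labels G) a
  | .tensor F G, _, _, a => labels F a.1 ∪ labels G a.2
  | .sym _ F, _, _, a => Finset.univ.biUnion fun i => labels F (a i)

/-- A bound for the number of labels of an index. -/
def arity : Construction → ℕ
  | .id => 1
  | .prod F G => max (arity F) (arity G)
  | .tensor F G => arity F + arity G
  | .sym k F => k * arity F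

theorem card_labels_le (F : Construction) {α : Type} [DecidableEq α] (a : Idx F α) :
    (labels F a).card ≤ arity F := by
  induction F with
  | id => exact (Finset.card_singleton _).le
  | prod F G hF hG =>
    rcases a with a | a
    · exact (hF a).trans (le_max_left _ _)
    · exact (hG a).trans (le_max_right _ _)
  | tensor F G hF hG =>
    exact (Finset.card_union_le _ _).trans (add_le_add (hF a.1) (hG a.2))
  | sym k F hF =>
    refine Finset.card_biUnion_le.trans ((Finset.sum_le_sum fun i _ => hF (a i)).trans ?_)
    simp [arity]

theorem mem_range_map_iff (F : Construction) {α β : Type} [DecidableEq β] (g : α → β)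
    (b : Idx F β) : b ∈ Set.range (Idx.map F g) ↔ ∀ i ∈ labels F b, i ∈ Set.range g := by
  induction F with
  | id =>
    refine ⟨fun h i hi => ?_, fun h => h b (Finset.mem_singleton_self _)⟩
    rwa [Finset.mem_singleton.1 hi]
  | prod F G hF hG =>
    rcases b with b | b
    · refine Iff.trans ⟨?_, ?_⟩ (hF b)
      · rintro ⟨a | a, h⟩
        exacts [⟨a, Sum.inl_injective h⟩, (Sum.inr_ne_inl h).elim]
      · rintro ⟨a, rfl⟩
        exact ⟨Sum.inl a, rfl⟩
    · refine Iff.trans ⟨?_, ?_⟩ (hG b)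
      · rintro ⟨a | a, h⟩
        exacts [(Sum.inl_ne_inr h).elim, ⟨a, Sum.inr_injective h⟩]
      · rintro ⟨a, rfl⟩
        exact ⟨Sum.inr a, rfl⟩
  | tensor F G hF hG =>
    have h1 : b ∈ Set.range (Idx.map (.tensor F G) g) ↔
        b.1 ∈ Set.range (Idx.map F g) ∧ b.2 ∈ Set.range (Idx.map G g) := by
      refine ⟨?_, ?_⟩
      · rintro ⟨a, rfl⟩
        exact ⟨⟨a.1, rfl⟩, ⟨a.2, rfl⟩⟩
      · rintro ⟨⟨a, ha⟩, ⟨c, hc⟩⟩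
        exact ⟨(a, c), Prod.ext ha hc⟩
    rw [h1, hF, hG]
    change _ ↔ ∀ i ∈ labels F b.1 ∪ labels G b.2, _
    simp only [Finset.mem_union, or_imp, forall_and]
  | sym k F hF =>
    have h1 : b ∈ Set.range (Idx.map (.sym k F) g) ↔ ∀ i, b i ∈ Set.range (Idx.map F g) := by
      refine ⟨?_, fun h => ?_⟩
      · rintro ⟨a, rfl⟩ i
        exact ⟨a i, rfl⟩
      · choose a ha using h
        exact ⟨a, funext ha⟩
    rw [h1]
    change _ ↔ ∀ i ∈ Finset.univ.biUnion fun i => labels F (b i), _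
    simp only [hF, Finset.mem_biUnion, Finset.mem_univ, true_and, forall_exists_index]
    exact forall_comm

theorem push_pull_apply (F : Construction) {α β : Type} [Fintype α] [DecidableEq β] {g : α → β}
    (hg : g.Injective) (x : V F β) (b : Idx F β) [Decidable (∀ i ∈ labels F b, i ∈ Set.range g)] :
    (push F g (pull F g x)).1 b = if ∀ i ∈ labels F b, i ∈ Set.range g then x.1 b else 0 := by
  split_ifs with h
  · obtain ⟨a, rfl⟩ := (mem_range_map_iff F g b).2 h
    exact push_apply_map F hg _ a
  · exact push_apply_of_notMem F g _ fun h' => h ((mem_range_map_iff F g b).1 h')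

/-! ### Injections, equipartitions and averages over maps of finite sets -/

/-- Any two injections into a finite set differ by a permutation of the target. -/
theorem exists_perm_comp_eq {α β : Type} [Finite β] {g g' : α → β} (hg : g.Injective)
    (hg' : g'.Injective) : ∃ σ : Equiv.Perm β, σ ∘ g = g' := by
  classical
  have := Fintype.ofFinite β
  let e : {b // b ∈ Set.range g} ≃ {b // b ∈ Set.range g'} :=
    (Equiv.ofInjective g hg).symm.trans (Equiv.ofInjective g' hg')
  refine ⟨e.extendSubtype, funext fun a => ?_⟩
  refine (Equiv.extendSubtype_apply_of_mem e (g a) ⟨a, rfl⟩).trans ?_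
  have : (Equiv.ofInjective g hg).symm ⟨g a, ⟨a, rfl⟩⟩ = a :=
    Equiv.ofInjective_symm_apply hg a
  simp [e, this]

/-- The fibres of `h` all have the same size: up to a bijection, `h` is the first projection of a
product. -/
def EquiFibered {α β : Type} (h : α → β) : Prop :=
  ∃ (r : ℕ) (e : α ≃ β × Fin r), h = Prod.fst ∘ e

theorem EquiFibered.comp {α β γ : Type} {h : α → β} {h' : β → γ} (H : EquiFibered h)
    (H' : EquiFibered h') : EquiFibered (h' ∘ h) := by
  obtain ⟨r, e, rfl⟩ := H
  obtain ⟨s, e', rfl⟩ := H'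
  exact ⟨s * r, e.trans ((e'.prodCongr (Equiv.refl _)).trans
    ((Equiv.prodAssoc _ _ _).trans ((Equiv.refl _).prodCongr finProdFinEquiv))), rfl⟩

theorem EquiFibered.of_equiv {α β : Type} (e : α ≃ β) : EquiFibered e :=
  ⟨1, e.trans (Equiv.prodUnique β (Fin 1)).symm, rfl⟩

/-- Any two equifibred maps differ by a permutation of the source. -/
theorem EquiFibered.exists_perm_comp_eq {α β : Type} [Finite α] [Nonempty β] [Finite β]
    {h h' : α → β} (H : EquiFibered h) (H' : EquiFibered h') :
    ∃ σ : Equiv.Perm α, h' = h ∘ σ := by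
  obtain ⟨r, e, rfl⟩ := H
  obtain ⟨s, e', rfl⟩ := H'
  obtain rfl : r = s := by
    have h1 := Nat.card_congr (e.symm.trans e')
    rw [Nat.card_prod, Nat.card_prod] at h1
    simpa using Nat.eq_of_mul_eq_mul_left Nat.card_pos h1
  exact ⟨e'.trans e.symm, by funext a; simp⟩

theorem equiFibered_equipart {n N : ℕ+} (h : n ∣ N) : EquiFibered (equipart h) := by
  have hN : (N : ℕ) = n * ((N : ℕ) / n) := (Nat.mul_div_cancel' (PNat.dvd_iff.1 h)).symm
  exact ⟨(N : ℕ) / n, (finCongr hN).trans finProdFinEquiv.symm, rfl⟩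

theorem incl_injective {n N : ℕ+} (h : n ≤ N) : (incl h).Injective := Fin.castLE_injective h

theorem equipart_refl {n : ℕ+} (h : n ∣ n) : equipart h = _root_.id := by
  funext j
  refine Fin.ext ?_
  change (j : ℕ) / ((n : ℕ) / n) = j
  rw [Nat.div_self n.pos, Nat.div_one]

/-- Every map factors through an embedding, a permutation and an equipartition. -/
theorem exists_eq_equipart_comp {a b : ℕ+} (f : Fin a → Fin b) :
    ∃ (N : ℕ+) (h : a ≤ N) (h' : b ∣ N) (σ : Equiv.Perm (Fin N)),
      f = equipart h' ∘ σ ∘ incl h := by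
  have h' : b ∣ b * a := dvd_mul_right b a
  have h : a ≤ b * a := PNat.le_of_dvd (dvd_mul_left a b)
  obtain ⟨r, e, he⟩ := equiFibered_equipart h'
  -- The fibres have `a` elements, enough for an injection that sends `i` into the one over `f i`.
  obtain rfl : r = a := by
    have h1 := Nat.card_congr e
    rw [Nat.card_prod] at h1
    simp only [Nat.card_fin, PNat.mul_coe] at h1
    exact (Nat.eq_of_mul_eq_mul_left b.pos h1).symm
  have hg : Function.Injective fun i : Fin a => e.symm (f i, i) := fun i j hij =>
    (Prod.ext_iff.1 (e.symm.injective hij)).2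
  obtain ⟨σ, hσ⟩ := exists_perm_comp_eq (incl_injective h) hg
  refine ⟨b * a, h, h', σ, ?_⟩
  rw [hσ, he]
  exact funext fun i => (congrArg Prod.fst (e.apply_symm_apply (f i, i))).symm

/-- Every map to a large enough set is an injection after a self-map of its domain. -/
theorem exists_eq_injective_comp {k n : ℕ} (hkn : k ≤ n) (f : Fin k → Fin n) :
    ∃ (g : Fin k → Fin n) (π : Fin k → Fin k), g.Injective ∧ f = g ∘ π := by
  obtain ⟨S, hS, hcard⟩ := Finset.exists_superset_card_eq (s := Finset.univ.image f) (n := k)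
    (Finset.card_image_le.trans (by simp)) (by simpa using hkn)
  refine ⟨S.orderEmbOfFin hcard, fun i => (S.orderIsoOfFin hcard).symm
    ⟨f i, hS (Finset.mem_image_of_mem f (Finset.mem_univ i))⟩,
    (S.orderEmbOfFin hcard).injective, ?_⟩
  funext i
  simp [← Finset.coe_orderIsoOfFin_apply]

theorem sum_perm_comp_injective {α β : Type} [Fintype β] [DecidableEq β] {g g' : α → β}
    (hg : g.Injective) (hg' : g'.Injective) (H : (α → β) → ℝ) :
    ∑ σ : Equiv.Perm β, H (σ ∘ g) = ∑ σ : Equiv.Perm β, H (σ ∘ g') := by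
  obtain ⟨τ, rfl⟩ := exists_perm_comp_eq hg' hg
  exact Fintype.sum_equiv (Equiv.mulRight τ) _ _ fun σ => rfl

theorem EquiFibered.sum_perm_comp {α β : Type} [Fintype α] [DecidableEq α] [Finite β]
    [Nonempty β] {h h' : α → β} (hh : EquiFibered h) (hh' : EquiFibered h')
    (H : (α → β) → ℝ) :
    ∑ σ : Equiv.Perm α, H (h ∘ σ) = ∑ σ : Equiv.Perm α, H (h' ∘ σ) := by
  obtain ⟨τ, rfl⟩ := hh'.exists_perm_comp_eq hh
  exact Fintype.sum_equiv (Equiv.mulLeft τ) _ _ fun σ => rfl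

/-- The average of a function of the first component of a product. -/
theorem average_comp_fst {X Y Z : Type} [Fintype X] [Fintype Y] [Fintype Z] [Nonempty Z]
    (e : X ≃ Y × Z) (H : Y → ℝ) :
    (Fintype.card X : ℝ)⁻¹ * ∑ x, H (e x).1 = (Fintype.card Y : ℝ)⁻¹ * ∑ y, H y := by
  have h1 : ∑ x, H (e x).1 = Fintype.card Z * ∑ y, H y := by
    rw [Fintype.sum_equiv e (fun x => H (e x).1) (fun p => H p.1) fun _ => rfl,
      Fintype.sum_prod_type]
    simp [Finset.mul_sum]
  have h2 : (Fintype.card Z : ℝ) ≠ 0 := Nat.cast_ne_zero.2 Fintype.card_ne_zero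
  rw [h1, Fintype.card_congr e, Fintype.card_prod, Nat.cast_mul, mul_inv]
  field_simp

theorem average_comp_injective {α β γ : Type} [Fintype α] [DecidableEq α] [Fintype β]
    [DecidableEq β] [Fintype γ] [Nonempty γ] {h : α → β} (hh : h.Injective)
    (H : (α → γ) → ℝ) :
    (Fintype.card (β → γ) : ℝ)⁻¹ * ∑ f : β → γ, H (f ∘ h) =
      (Fintype.card (α → γ) : ℝ)⁻¹ * ∑ f : α → γ, H f := by
  classical
  -- A map on `β` is a map on the range of `h` together with one on its complement.
  let e : β ≃ α ⊕ ((Set.range h)ᶜ : Set β) := (Equiv.Set.sumCompl (Set.range h)).symm.trans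
    (Equiv.sumCongr (Equiv.ofInjective h hh).symm (Equiv.refl _))
  have he : ∀ a, e (h a) = Sum.inl a := fun a => by
    rw [← Equiv.eq_symm_apply]
    simp [e]
  rw [← average_comp_fst ((Equiv.arrowCongr e (Equiv.refl γ)).trans
    (Equiv.sumArrowEquivProdArrow α _ γ)) H]
  refine congrArg _ (Finset.sum_congr rfl fun f _ => congrArg H (funext fun a => ?_))
  change f (h a) = f (e.symm (Sum.inl a))
  rw [← he, e.symm_apply_apply]

theorem EquiFibered.average_comp {α β γ : Type} [Fintype α] [DecidableEq α] [Fintype β]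
    [Nonempty β] [Fintype γ] [DecidableEq γ] {h : β → γ} [Nonempty γ] (hh : EquiFibered h)
    (H : (α → γ) → ℝ) :
    (Fintype.card (α → β) : ℝ)⁻¹ * ∑ f : α → β, H (h ∘ f) =
      (Fintype.card (α → γ) : ℝ)⁻¹ * ∑ f : α → γ, H f := by
  obtain ⟨r, e, rfl⟩ := hh
  have : Nonempty (Fin r) := ⟨(e (Classical.arbitrary β)).2⟩
  exact average_comp_fst ((Equiv.arrowCongr (Equiv.refl α) e).trans
    (Equiv.arrowProdEquivProdArrow α (fun _ => γ) (fun _ => Fin r))) H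

/-! ### Polynomials of bounded degree are determined by few labels -/

/-- The part of an array that involves only the labels in `S`. -/
def trunc (F : Construction) {α : Type} [DecidableEq α] (S : Finset α) (x : Idx F α → ℝ) :
    Idx F α → ℝ :=
  fun b => if labels F b ⊆ S then x b else 0

theorem trunc_insert_of_notMem (F : Construction) {α : Type} [DecidableEq α] {S : Finset α}
    (x : Idx F α → ℝ) {b : Idx F α} {i : α} (hi : i ∉ labels F b) :
    trunc F (insert i S) x b = trunc F S x b := by
  simp only [trunc, Finset.subset_insert_iff_of_notMem hi]

/-- The finite differences of order larger than `d * arity F` vanish: each monomial involves at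
most `d * arity F` labels, so that some label of `S` can be added and removed freely. -/
theorem sum_powerset_eval_trunc {F : Construction} {α : Type} [DecidableEq α] {d : ℕ}
    {P : MvPolynomial (Idx F α) ℝ} (hP : P.totalDegree ≤ d) {S : Finset α}
    (hS : d * arity F < S.card) (i₀ : α) (x : Idx F α → ℝ) :
    ∑ T ∈ S.powerset, (-1 : ℝ) ^ T.card * MvPolynomial.eval (trunc F (insert i₀ T) x) P = 0 := by
  classical
  simp only [MvPolynomial.eval_eq, Finset.mul_sum]
  rw [Finset.sum_comm]
  refine Finset.sum_eq_zero fun m hm => ?_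
  have hcard : (m.support.biUnion (labels F)).card < S.card := by
    refine lt_of_le_of_lt (Finset.card_biUnion_le.trans
      (Finset.sum_le_card_nsmul _ _ _ fun b _ => card_labels_le F b)) (lt_of_le_of_lt ?_ hS)
    refine Nat.mul_le_mul_right _ (le_trans ?_ ((MvPolynomial.le_totalDegree hm).trans hP))
    rw [Finset.card_eq_sum_ones]
    exact Finset.sum_le_sum fun b hb => Nat.one_le_iff_ne_zero.2 (Finsupp.mem_support_iff.1 hb)
  obtain ⟨i, hiS, hi⟩ := Finset.exists_mem_notMem_of_card_lt_card hcard
  rw [← Finset.insert_erase hiS, Finset.sum_powerset_insert (Finset.notMem_erase i S),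
    ← Finset.sum_add_distrib]
  refine Finset.sum_eq_zero fun T hT => ?_
  have hiT : i ∉ T := fun h => Finset.notMem_erase i S (Finset.mem_powerset.1 hT h)
  have h1 : ∏ b ∈ m.support, trunc F (insert i₀ (insert i T)) x b ^ m b =
      ∏ b ∈ m.support, trunc F (insert i₀ T) x b ^ m b := by
    refine Finset.prod_congr rfl fun b hb => ?_
    rw [Finset.insert_comm, trunc_insert_of_notMem F x fun h =>
      hi (Finset.mem_biUnion.2 ⟨b, hb, h⟩)]
  rw [h1, Finset.card_insert_of_notMem hiT, pow_succ]
  ring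

/-- A polynomial of degree at most `d` lies in the span of its restrictions to the arrays that
involve at most `d * arity F + 1` labels. -/
theorem mem_of_forall_comp_push_pull {F : Construction} {d : ℕ} {n : ℕ+}
    (W : Submodule ℝ (Space F n → ℝ)) {p : Space F n → ℝ} (hp : p ∈ Poly F d n)
    (hW : ∀ (m : ℕ+) (g : Fin m → Fin n), (m : ℕ) ≤ d * arity F + 1 → g.Injective →
      (fun x => p (push F g (pull F g x))) ∈ W) : p ∈ W := by
  classical
  obtain ⟨P, hP, hpP⟩ := hp
  -- Dimensions are positive, so only nonempty sets of labels come from an injection; all the sets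
  -- considered contain `i₀`.
  let i₀ : Fin n := ⟨0, n.pos⟩
  let G : Finset (Fin n) → Space F n → ℝ := fun T x =>
    MvPolynomial.eval (trunc F (insert i₀ T) x.1) P
  have hG : ∀ T, G T ∈ W := by
    intro T
    induction T using Finset.strongInduction with
    | H T ih =>
      by_cases hT : d * arity F < T.card
      · have h1 : G T = ∑ T' ∈ T.ssubsets, -((-1 : ℝ) ^ T.card * (-1) ^ T'.card) • G T' := by
          funext x
          have h2 := sum_powerset_eval_trunc hP hT i₀ x.1
          rw [← Finset.add_sum_erase _ _ (Finset.mem_powerset_self T)] at h2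
          have h3 : ((-1 : ℝ) ^ T.card) * (-1) ^ T.card = 1 := by
            rw [← mul_pow]; simp
          rw [Finset.sum_apply]
          simp only [Pi.smul_apply, smul_eq_mul, neg_mul, Finset.sum_neg_distrib, mul_assoc,
            ← Finset.mul_sum]
          change _ = -((-1 : ℝ) ^ T.card * ∑ T' ∈ T.powerset.erase T, _)
          rw [← eq_neg_iff_add_eq_zero] at h2
          rw [← mul_neg, ← h2, ← mul_assoc, h3, one_mul]
        rw [h1]
        exact Submodule.sum_mem _ fun T' hT' =>
          W.smul_mem _ (ih T' (Finset.mem_ssubsets.1 hT'))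
      · let m : ℕ+ := ⟨(insert i₀ T).card, Finset.card_pos.2 (Finset.insert_nonempty _ _)⟩
        let g : Fin m → Fin n := (insert i₀ T).orderEmbOfFin rfl
        have hg : g.Injective := ((insert i₀ T).orderEmbOfFin rfl).injective
        have hrange : Set.range g = ↑(insert i₀ T) := Finset.range_orderEmbOfFin _ _
        convert hW m g ((Finset.card_insert_le _ _).trans (by omega)) hg using 1
        funext x
        rw [hpP]
        refine congrArg (fun y => MvPolynomial.eval y P) (funext fun b => ?_)
        rw [push_pull_apply F hg]
        refine if_congr (forall₂_congr fun i _ => ?_) rfl rfl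
        rw [hrange, Finset.mem_coe]
  convert hG Finset.univ using 1
  funext x
  rw [hpP]
  refine congrArg (fun y => MvPolynomial.eval y P) (funext fun b => ?_)
  exact (if_pos fun i _ => Finset.mem_insert_of_mem (Finset.mem_univ i)).symm

/-! ### Invariant polynomials and symmetrization -/

theorem inv_apply_push {F : Construction} {d : ℕ} {n : ℕ+} (p : Inv F d n)
    (σ : Equiv.Perm (Fin n)) (x : Space F n) : p.1 (push F σ x) = p.1 x := by
  rw [← act_eq_push]
  exact p.2.2 σ x

theorem inv_apply_pull {F : Construction} {d : ℕ} {n : ℕ+} (p : Inv F d n)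
    (σ : Equiv.Perm (Fin n)) (x : Space F n) : p.1 (pull F σ x) = p.1 x :=
  p.2.2 σ.symm x

theorem inv_apply_push_injective {F : Construction} {d : ℕ} {α : Type} [Fintype α] {n : ℕ+}
    (p : Inv F d n) {f g : α → Fin n} (hf : f.Injective) (hg : g.Injective) (x : V F α) :
    p.1 (push F f x) = p.1 (push F g x) := by
  obtain ⟨σ, rfl⟩ := exists_perm_comp_eq hf hg
  rw [← push_push, inv_apply_push]

instance Poly.finiteDimensional (F : Construction) (d : ℕ) (n : ℕ+) :
    FiniteDimensional ℝ (Poly F d n) := by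
  let ev : MvPolynomial.restrictTotalDegree (Idx F (Fin n)) ℝ d →ₗ[ℝ] (Space F n → ℝ) :=
    { toFun := fun P x => MvPolynomial.eval x.1 P.1
      map_add' := fun P Q => funext fun x => by simp
      map_smul' := fun c P => funext fun x => by simp }
  have h : Poly F d n ≤ LinearMap.range ev := by
    rintro p ⟨P, hP, hp⟩
    exact ⟨⟨P, (MvPolynomial.mem_restrictTotalDegree _ _ _).2 hP⟩, funext fun x => (hp x).symm⟩
  exact Submodule.finiteDimensional_of_le h

instance Inv.finiteDimensional (F : Construction) (d : ℕ) (n : ℕ+) :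
    FiniteDimensional ℝ (Inv F d n) :=
  Submodule.finiteDimensional_of_le (S₂ := Poly F d n) fun _ hp => hp.1

/-- Averaging over `S_n`. -/
def symInv (F : Construction) (d : ℕ) (n : ℕ+) : Poly F d n →ₗ[ℝ] Inv F d n where
  toFun q := ⟨(Fintype.card (Equiv.Perm (Fin n)) : ℝ)⁻¹ •
      ∑ σ : Equiv.Perm (Fin n), fun x => q.1 (pull F σ x),
    Submodule.smul_mem _ _ (Submodule.sum_mem _ fun σ _ => poly_comp_pull _ q.2),
    fun τ x => by
      simp only [Pi.smul_apply, Finset.sum_apply]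
      refine congrArg _ (Fintype.sum_equiv (Equiv.mulLeft τ⁻¹) _ _ fun σ => ?_)
      rw [act_eq_pull, pull_pull]
      rfl⟩
  map_add' p q := Subtype.ext (funext fun x => by
    simp [Finset.sum_add_distrib, mul_add])
  map_smul' c q := Subtype.ext (funext fun x => by
    simp only [Submodule.coe_smul, Pi.smul_apply, smul_eq_mul, Finset.sum_apply,
      ← Finset.mul_sum, RingHom.id_apply]
    ring)

theorem symInv_apply {F : Construction} {d : ℕ} {n : ℕ+} (q : Poly F d n) (x : Space F n) :
    (symInv F d n q).1 x = (Fintype.card (Equiv.Perm (Fin n)) : ℝ)⁻¹ *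
      ∑ σ : Equiv.Perm (Fin n), q.1 (pull F σ x) := by
  simp [symInv]

theorem average_const {X : Type} [Fintype X] [Nonempty X] (c : ℝ) :
    (Fintype.card X : ℝ)⁻¹ * ∑ _x : X, c = c := by
  have h2 : (Fintype.card X : ℝ) ≠ 0 := Nat.cast_ne_zero.2 Fintype.card_ne_zero
  rw [Finset.sum_const, Finset.card_univ, nsmul_eq_mul, inv_mul_cancel_left₀ h2]

theorem symInv_of_inv {F : Construction} {d : ℕ} {n : ℕ+} (q : Inv F d n) :
    symInv F d n ⟨q.1, q.2.1⟩ = q := by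
  refine Subtype.ext (funext fun x => ?_)
  rw [symInv_apply]
  simp only [inv_apply_pull]
  exact average_const _

theorem average_average {X Y : Type} [Fintype X] [Fintype Y] [Nonempty Y] {H : X → Y → ℝ}
    {S : ℝ} (hH : ∀ y, ∑ x, H x y = S) :
    (Fintype.card X : ℝ)⁻¹ * ∑ x, ((Fintype.card Y : ℝ)⁻¹ * ∑ y, H x y) =
      (Fintype.card X : ℝ)⁻¹ * S := by
  rw [← Finset.mul_sum, Finset.sum_comm]
  simp only [hH]
  rw [average_const]

theorem Kind.zeroPad_le_iff {n N : ℕ+} : Kind.zeroPad.le n N ↔ n ≤ N := Iff.rfl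

theorem Kind.dup_le_iff {n N : ℕ+} : Kind.dup.le n N ↔ n ∣ N := Iff.rfl

theorem symMap_zeroPad_apply {F : Construction} {d : ℕ} {n N : ℕ+} (h : Kind.zeroPad.le n N)
    (q : Inv F d n) (x : Space F N) :
    (symMap F d .zeroPad h q).1 x = (Fintype.card (Equiv.Perm (Fin N)) : ℝ)⁻¹ *
      ∑ σ : Equiv.Perm (Fin N), q.1 (pull F (σ ∘ incl (Kind.zeroPad_le_iff.1 h)) x) := by
  refine congrArg _ (Fintype.sum_equiv (Equiv.inv _) _ _ fun σ => ?_)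
  change q.1 (pull F (incl h) (act F σ x)) = _
  rw [act_eq_pull, pull_pull]
  rfl

theorem symMap_dup_apply {F : Construction} {d : ℕ} {n N : ℕ+} (h : Kind.dup.le n N)
    (q : Inv F d n) (x : Space F N) :
    (symMap F d .dup h q).1 x = (Fintype.card (Equiv.Perm (Fin N)) : ℝ)⁻¹ *
      ∑ σ : Equiv.Perm (Fin N), q.1 (push F (equipart (Kind.dup_le_iff.1 h) ∘ σ) x) := by
  refine congrArg _ (Finset.sum_congr rfl fun σ _ => ?_)
  change q.1 (push F (equipart h) (act F σ x)) = _
  rw [act_eq_push, push_push]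

/-- Symmetrizing a polynomial in the entries with labels in the image of an injection gives the same
result for all injections, namely that of `symMap`. -/
theorem symInv_comp_pull {F : Construction} {d : ℕ} {n N : ℕ+} (h : Kind.zeroPad.le n N)
    {g : Fin n → Fin N} (hg : g.Injective) (q : Poly F d n) :
    symInv F d N ⟨fun x => q.1 (pull F g x), poly_comp_pull g q.2⟩ =
      symMap F d .zeroPad h (symInv F d n q) := by
  refine Subtype.ext (funext fun x => ?_)
  rw [symInv_apply, symMap_zeroPad_apply]
  simp only [symInv_apply, pull_pull]
  refine (average_average fun τ => ?_).symm
  exact sum_perm_comp_injective ((incl_injective h).comp τ.injective) hg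
    fun f => q.1 (pull F f x)

theorem symMap_refl {F : Construction} {d : ℕ} (κ : Kind) {n : ℕ+} (h : κ.le n n)
    (q : Inv F d n) : symMap F d κ h q = q := by
  refine Subtype.ext (funext fun x => ?_)
  cases κ with
  | zeroPad =>
    rw [symMap_zeroPad_apply]
    exact (congrArg _ (Finset.sum_congr rfl fun σ _ => inv_apply_pull q σ x)).trans
      (average_const _)
  | dup =>
    rw [symMap_dup_apply]
    simp only [equipart_refl, Function.id_comp, inv_apply_push]
    exact average_const _

theorem symMap_symMap {F : Construction} {d : ℕ} (κ : Kind) {n N M : ℕ+} (h : κ.le n N)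
    (h' : κ.le N M) (h'' : κ.le n M) (q : Inv F d n) :
    symMap F d κ h' (symMap F d κ h q) = symMap F d κ h'' q := by
  refine Subtype.ext (funext fun x => ?_)
  cases κ with
  | zeroPad =>
    simp only [symMap_zeroPad_apply, pull_pull]
    exact average_average fun τ => sum_perm_comp_injective
      ((incl_injective h').comp (τ.injective.comp (incl_injective h))) (incl_injective h'')
      fun f => q.1 (pull F f x)
  | dup =>
    simp only [symMap_dup_apply, push_push]
    have : Nonempty (Fin n) := ⟨⟨0, n.pos⟩⟩
    refine average_average fun τ => EquiFibered.sum_perm_comp (h := (equipart h ∘ τ) ∘ equipart h')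
      ((equiFibered_equipart h').comp ((EquiFibered.of_equiv τ).comp (equiFibered_equipart h)))
      (equiFibered_equipart h'') fun f => q.1 (push F f x)

instance (F : Construction) (d : ℕ) (κ : Kind) :
    DirectedSystem (fun n : Level κ => Inv F d n.dim) (fun _ _ h => symMap F d κ h) where
  map_self _ q := symMap_refl κ _ q
  map_map _ _ _ _ _ q := symMap_symMap κ _ _ _ q

theorem Kind.le_of_dvd (κ : Kind) {n N : ℕ+} (h : n ∣ N) : κ.le n N := by
  cases κ
  exacts [PNat.le_of_dvd h, h]

instance (κ : Kind) : IsDirectedOrder (Level κ) where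
  directed a b := ⟨⟨a.dim * b.dim⟩, κ.le_of_dvd (dvd_mul_right _ _), κ.le_of_dvd (dvd_mul_left _ _)⟩

instance (κ : Kind) : Nonempty (Level κ) := ⟨⟨1⟩⟩

/-! ### Stabilization of the spaces of invariant polynomials -/

/-- Restriction of an invariant polynomial along zero-padding. -/
def restr (F : Construction) (d : ℕ) {n N : ℕ+} (h : n ≤ N) : Inv F d N →ₗ[ℝ] Inv F d n where
  toFun p := ⟨fun x => p.1 (push F (incl h) x), poly_comp_push _ p.2.1, fun σ x => by
    simp only [act_eq_push, push_push]
    exact inv_apply_push_injective p ((incl_injective h).comp σ.injective) (incl_injective h) x⟩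
  map_add' _ _ := rfl
  map_smul' _ _ := rfl

theorem restr_apply {F : Construction} {d : ℕ} {n N : ℕ+} (h : n ≤ N) (p : Inv F d N)
    (x : Space F n) : (restr F d h p).1 x = p.1 (push F (incl h) x) := rfl

theorem restr_restr {F : Construction} {d : ℕ} {n N M : ℕ+} (h : n ≤ N) (h' : N ≤ M)
    (p : Inv F d M) : restr F d h (restr F d h' p) = restr F d (h.trans h') p :=
  Subtype.ext (funext fun x => by simp only [restr_apply, push_push]; rfl)

/-- The dimension from which on all the labels of a polynomial of degree `d` can be seen. -/
def bound (F : Construction) (d : ℕ) : ℕ+ := ⟨d * arity F + 1, Nat.succ_pos _⟩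

/-- An invariant polynomial is determined by its restriction to `bound F d` labels, since a
permutation moves any other such set of labels there. -/
theorem restr_injective {F : Construction} {d : ℕ} {n N : ℕ+} (hn : bound F d ≤ n) (h : n ≤ N) :
    Function.Injective (restr F d h) := by
  rw [injective_iff_map_eq_zero]
  intro p hp
  refine Subtype.ext ?_
  refine (Submodule.mem_bot ℝ).1 (mem_of_forall_comp_push_pull ⊥ p.2.1 fun m g hm hg => ?_)
  refine (Submodule.mem_bot ℝ).2 (funext fun x => ?_)
  have hmn : m ≤ n := le_trans (show m ≤ bound F d from hm) hn
  rw [inv_apply_push_injective p hg ((incl_injective h).comp (incl_injective hmn)), ← push_push,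
    ← restr_apply, hp]
  rfl

/-- An invariant polynomial is the symmetrization of a combination of polynomials in at most
`bound F d` labels. -/
theorem symMap_zeroPad_surjective {F : Construction} {d : ℕ} {n N : ℕ+} (hn : bound F d ≤ n)
    (h : Kind.zeroPad.le n N) : Function.Surjective (symMap F d .zeroPad h) := by
  intro p
  let W : Submodule ℝ (Space F N → ℝ) := ((LinearMap.range (symMap F d .zeroPad h)).comap
    (symInv F d N)).map (Poly F d N).subtype
  have hp : p.1 ∈ W := by
    refine mem_of_forall_comp_push_pull W p.2.1 fun m g hm hg => ?_
    have hmn : m ≤ n := le_trans (show m ≤ bound F d from hm) hn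
    let q : Poly F d m := ⟨fun x => p.1 (push F g x), poly_comp_push g p.2.1⟩
    refine ⟨⟨fun x => q.1 (pull F g x), poly_comp_pull g q.2⟩, ?_, rfl⟩
    refine ⟨symMap F d .zeroPad hmn (symInv F d m q), ?_⟩
    rw [symMap_symMap .zeroPad hmn h (le_trans (α := ℕ+) hmn h),
      symInv_comp_pull (le_trans (α := ℕ+) hmn h) hg q]
  obtain ⟨p', hp', hpp'⟩ := hp
  obtain rfl : p' = ⟨p.1, p.2.1⟩ := Subtype.ext hpp'
  obtain ⟨q, hq⟩ := hp'
  exact ⟨q, hq.trans (symInv_of_inv p)⟩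

/-- The dimensions of the spaces of invariant polynomials are eventually constant: from `bound F d` on
they do not increase. -/
theorem exists_finrank_inv_eq (F : Construction) (d : ℕ) : ∃ n₀ : ℕ+, bound F d ≤ n₀ ∧
    ∀ n, n₀ ≤ n → Module.finrank ℝ (Inv F d n) = Module.finrank ℝ (Inv F d n₀) := by
  obtain ⟨n₀, hn₀, hmin⟩ := exists_minimalFor_of_wellFoundedLT (fun n : ℕ+ => bound F d ≤ n)
    (fun n => Module.finrank ℝ (Inv F d n)) ⟨_, le_refl _⟩
  refine ⟨n₀, hn₀, fun n hn => ?_⟩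
  have h1 := LinearMap.finrank_le_finrank_of_injective (restr_injective (F := F) (d := d) hn₀ hn)
  exact le_antisymm h1 (hmin (le_trans hn₀ hn) h1)

/-! ### The map from the direct limit to the inverse limit -/

theorem average_average_left {X Y : Type} [Fintype X] [Fintype Y] [Nonempty Y] {H : X → Y → ℝ}
    {S : ℝ} (hH : ∀ y, (Fintype.card X : ℝ)⁻¹ * ∑ x, H x y = S) :
    (Fintype.card X : ℝ)⁻¹ * ∑ x, ((Fintype.card Y : ℝ)⁻¹ * ∑ y, H x y) = S := by
  rw [← Finset.mul_sum, Finset.sum_comm, mul_left_comm, Finset.mul_sum]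
  simp only [hH]
  exact average_const S

theorem deFinettiMean_mem {F : Construction} {d : ℕ} (κ : Kind) {k : ℕ+} (q : Inv F d k)
    (n : ℕ+) : deFinettiMean F κ q.1 n ∈ Inv F d n := by
  cases κ with
  | zeroPad =>
    refine ⟨?_, fun σ x => ?_⟩
    · have h1 : deFinettiMean F .zeroPad q.1 n = (Fintype.card (Fin n → Fin k) : ℝ)⁻¹ •
          ∑ f : Fin n → Fin k, fun x => q.1 (push F f x) := by
        funext x
        simp [deFinettiMean]
      rw [h1]
      exact Submodule.smul_mem _ _ (Submodule.sum_mem _ fun f _ => poly_comp_push f q.2.1)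
    · change _ * _ = _ * _
      refine congrArg _ (Fintype.sum_equiv (Equiv.arrowCongr σ.symm (Equiv.refl _)) _ _ fun f => ?_)
      rw [act_eq_push, push_push]
      rfl
  | dup =>
    refine ⟨?_, fun σ x => ?_⟩
    · have h1 : deFinettiMean F .dup q.1 n = (Fintype.card (Fin k → Fin n) : ℝ)⁻¹ •
          ∑ f : Fin k → Fin n, fun x => q.1 (pull F f x) := by
        funext x
        simp [deFinettiMean]
      rw [h1]
      exact Submodule.smul_mem _ _ (Submodule.sum_mem _ fun f _ => poly_comp_pull f q.2.1)
    · change _ * _ = _ * _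
      refine congrArg _ (Fintype.sum_equiv
        (Equiv.arrowCongr (Equiv.refl (Fin k)) σ.symm) _ _ fun f => ?_)
      rw [act_eq_pull, pull_pull]
      rfl

/-- A single invariant polynomial `q` gives the freely-described polynomial whose `n`-th term is
`x ↦ 𝔼 q(L_{k,n} x)`. -/
def meanMap (F : Construction) (d : ℕ) (κ : Kind) (k : ℕ+) :
    Inv F d k →ₗ[ℝ] FreelyDescribed F d κ where
  toFun q := ⟨fun n => ⟨deFinettiMean F κ q.1 n, deFinettiMean_mem κ q n⟩, fun n N h x => by
    change deFinettiMean F κ q.1 N (emb F κ h x) = deFinettiMean F κ q.1 n x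
    have : Nonempty (Fin n) := ⟨⟨0, n.pos⟩⟩
    have : Nonempty (Fin N) := ⟨⟨0, N.pos⟩⟩
    have : Nonempty (Fin k) := ⟨⟨0, k.pos⟩⟩
    cases κ with
    | zeroPad =>
      simp only [deFinettiMean, emb, push_push]
      exact average_comp_injective (incl_injective h) fun f => q.1 (push F f x)
    | dup =>
      simp only [deFinettiMean, emb, pull_pull]
      exact (equiFibered_equipart h).average_comp fun f => q.1 (pull F f x)⟩
  map_add' p q := by
    refine Subtype.ext (funext fun n => Subtype.ext (funext fun x => ?_))
    cases κ <;> simp [deFinettiMean, Finset.sum_add_distrib, mul_add]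
  map_smul' c q := by
    refine Subtype.ext (funext fun n => Subtype.ext (funext fun x => ?_))
    cases κ <;> simp only [deFinettiMean, Submodule.coe_smul, Pi.smul_apply, smul_eq_mul,
      ← Finset.mul_sum, RingHom.id_apply] <;> ring

theorem meanMap_apply {F : Construction} {d : ℕ} {κ : Kind} {k : ℕ+} (q : Inv F d k) (n : ℕ+)
    (x : Space F n) : ((meanMap F d κ k q).1 n).1 x = deFinettiMean F κ q.1 n x := rfl

theorem meanMap_symMap {F : Construction} {d : ℕ} (κ : Kind) {k N : ℕ+} (h : κ.other.le k N)
    (q : Inv F d k) : meanMap F d κ N (symMap F d κ.other h q) = meanMap F d κ k q := by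
  refine Subtype.ext (funext fun n => Subtype.ext (funext fun x => ?_))
  rw [meanMap_apply, meanMap_apply]
  have : Nonempty (Fin n) := ⟨⟨0, n.pos⟩⟩
  have : Nonempty (Fin N) := ⟨⟨0, N.pos⟩⟩
  have : Nonempty (Fin k) := ⟨⟨0, k.pos⟩⟩
  cases κ with
  | zeroPad =>
    simp only [deFinettiMean, Kind.other, symMap_dup_apply, push_push]
    refine average_average_left fun σ => ?_
    exact EquiFibered.average_comp ((EquiFibered.of_equiv σ).comp (equiFibered_equipart h))
      fun f => q.1 (push F f x)
  | dup =>
    simp only [deFinettiMean, Kind.other, symMap_zeroPad_apply, pull_pull]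
    refine average_average_left fun σ => ?_
    exact average_comp_injective (σ.injective.comp (incl_injective h)) fun f => q.1 (pull F f x)

/-- The map induced by `meanMap` on the direct limit. -/
def limMap (F : Construction) (d : ℕ) (κ : Kind) :
    FreelySymmetrized F d κ.other →ₗ[ℝ] FreelyDescribed F d κ :=
  Module.DirectLimit.lift ℝ (Level κ.other) (fun n => Inv F d n.dim)
    (fun _ _ h => symMap F d κ.other h) (fun n => meanMap F d κ n.dim)
    fun _ _ h q => meanMap_symMap κ h q

theorem limMap_toLim {F : Construction} {d : ℕ} {κ : Kind} (k : ℕ+) (q : Inv F d k) :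
    limMap F d κ (toLim F d κ.other k q) = meanMap F d κ k q :=
  Module.DirectLimit.lift_of _ _ _

theorem toLim_symMap {F : Construction} {d : ℕ} {κ : Kind} {n N : ℕ+} (h : κ.le n N)
    (q : Inv F d n) : toLim F d κ N (symMap F d κ h q) = toLim F d κ n q :=
  Module.DirectLimit.of_f (i := (⟨n⟩ : Level κ)) (j := ⟨N⟩) (hij := h)

theorem exists_toLim_eq {F : Construction} {d : ℕ} {κ : Kind} (u : FreelySymmetrized F d κ) :
    ∃ (k : ℕ+) (q : Inv F d k), toLim F d κ k q = u := by
  obtain ⟨i, q, h⟩ := Module.DirectLimit.exists_of u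
  exact ⟨i.dim, q, h⟩

theorem exists_symMap_eq_zero {F : Construction} {d : ℕ} {κ : Kind} {n : ℕ+} {q : Inv F d n}
    (h : toLim F d κ n q = 0) : ∃ (N : ℕ+) (hN : κ.le n N), symMap F d κ hN q = 0 := by
  obtain ⟨j, hj, h⟩ := Module.DirectLimit.of.zero_exact h
  exact ⟨j.dim, hj, h⟩

/-! ### Dimensions of the limits -/

/-- Finitely many elements of the direct limit come from one common space of dimension `r`. -/
theorem rank_freelySymmetrized_le {F : Construction} {d r : ℕ} (κ : Kind) {n₀ : ℕ+}
    (hr : ∀ n, n₀ ≤ n → Module.finrank ℝ (Inv F d n) = r) :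
    Module.rank ℝ (FreelySymmetrized F d κ) ≤ r := by
  refine rank_le fun s hs => ?_
  choose k q hq using fun u : FreelySymmetrized F d κ => exists_toLim_eq u
  let N : ℕ+ := n₀ * ∏ u ∈ s, k u
  have hN : ∀ u ∈ s, κ.le (k u) N := fun u hu =>
    κ.le_of_dvd ((Finset.dvd_prod_of_mem k hu).trans (dvd_mul_left _ _))
  let v : s → Inv F d N := fun u => symMap F d κ (hN u.1 u.2) (q u.1)
  have hv : LinearIndependent ℝ v := by
    refine LinearIndependent.of_comp (toLim F d κ N) ?_
    convert hs using 1
    funext u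
    exact (toLim_symMap _ _).trans (hq u.1)
  have h1 := hv.fintype_card_le_finrank
  rwa [hr N (PNat.le_of_dvd (dvd_mul_right _ _)), Fintype.card_coe] at h1

/-- If a directed family of linear maps separates the points of `M`, then already one of them is
injective on any given finite-dimensional subspace. -/
theorem rank_le_of_directed_ker {M : Type} [AddCommGroup M] [Module ℝ M] {ι : Type} [Nonempty ι]
    {E : ι → Type} [∀ i, AddCommGroup (E i)] [∀ i, Module ℝ (E i)]
    [∀ i, FiniteDimensional ℝ (E i)] (f : ∀ i, M →ₗ[ℝ] E i) {r : ℕ}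
    (hr : ∀ i, Module.finrank ℝ (E i) ≤ r)
    (hdir : ∀ i j, ∃ l, LinearMap.ker (f l) ≤ LinearMap.ker (f i) ∧
      LinearMap.ker (f l) ≤ LinearMap.ker (f j))
    (hsep : ∀ x, (∀ i, f i x = 0) → x = 0) : Module.rank ℝ M ≤ r := by
  refine rank_le fun s hs => ?_
  let S := Submodule.span ℝ (s : Set M)
  have : FiniteDimensional ℝ S := FiniteDimensional.span_finset ℝ s
  let g : ∀ i, S →ₗ[ℝ] E i := fun i => (f i).comp S.subtype
  -- Where the kernel on the span has the least dimension, it is trivial.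
  obtain ⟨i, -, hmin⟩ := exists_minimalFor_of_wellFoundedLT (fun _ : ι => True)
    (fun i => Module.finrank ℝ (LinearMap.ker (g i))) ⟨Classical.arbitrary ι, trivial⟩
  have hker : LinearMap.ker (g i) = ⊥ := by
    refine (Submodule.eq_bot_iff _).2 fun p hp => Subtype.ext (hsep _ fun j => ?_)
    obtain ⟨l, hli, hlj⟩ := hdir i j
    have hle : LinearMap.ker (g l) ≤ LinearMap.ker (g i) := fun p hp => hli hp
    have h1 := Submodule.eq_of_le_of_finrank_le hle (hmin trivial (Submodule.finrank_mono hle))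
    rw [← h1] at hp
    exact hlj hp
  have h1 := LinearMap.finrank_le_finrank_of_injective (LinearMap.ker_eq_bot.1 hker)
  exact (finrank_span_finset_eq_card hs).symm.le.trans (h1.trans (hr i))

theorem ker_proj_le {F : Construction} {d : ℕ} {κ : Kind} {n N : ℕ+} (h : κ.le n N) :
    LinearMap.ker (proj F d κ N) ≤ LinearMap.ker (proj F d κ n) := by
  intro p hp
  refine LinearMap.mem_ker.2 (Subtype.ext (funext fun x => ?_))
  have h1 := p.2 n N h x
  have h2 : p.1 N = 0 := LinearMap.mem_ker.1 hp
  rw [h2] at h1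
  exact h1.symm

theorem rank_freelyDescribed_le {F : Construction} {d r : ℕ} (κ : Kind) {n₀ : ℕ+}
    (hr : ∀ n, n₀ ≤ n → Module.finrank ℝ (Inv F d n) = r) :
    Module.rank ℝ (FreelyDescribed F d κ) ≤ r := by
  refine rank_le_of_directed_ker (M := FreelyDescribed F d κ)
    (E := fun m : ℕ+ => Inv F d (n₀ * m)) (fun m => proj F d κ (n₀ * m))
    (fun m => (hr _ (PNat.le_of_dvd (dvd_mul_right _ _))).le) (fun i j => ⟨i * j, ?_, ?_⟩)
    fun p hp => ?_
  · exact ker_proj_le (κ.le_of_dvd (mul_dvd_mul_left _ (dvd_mul_right _ _)))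
  · exact ker_proj_le (κ.le_of_dvd (mul_dvd_mul_left _ (dvd_mul_left _ _)))
  · exact Subtype.ext (funext fun m => ker_proj_le (κ.le_of_dvd (dvd_mul_left m n₀)) (hp m))

theorem finite_of_rank_le {M : Type} [AddCommGroup M] [Module ℝ M] {r : ℕ}
    (h : Module.rank ℝ M ≤ r) : FiniteDimensional ℝ M :=
  Module.rank_lt_aleph0_iff.1 (h.trans_lt (Cardinal.natCast_lt_aleph0 (n := r)))

instance (F : Construction) (d : ℕ) (κ : Kind) : FiniteDimensional ℝ (FreelyDescribed F d κ) := by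
  obtain ⟨n₀, -, h⟩ := exists_finrank_inv_eq F d
  exact finite_of_rank_le (rank_freelyDescribed_le κ h)

instance (F : Construction) (d : ℕ) (κ : Kind) :
    FiniteDimensional ℝ (FreelySymmetrized F d κ) := by
  obtain ⟨n₀, -, h⟩ := exists_finrank_inv_eq F d
  exact finite_of_rank_le (rank_freelySymmetrized_le κ h)

/-- Surjective maps between spaces of the same dimension are injective, so that no element of a large
dimension becomes zero in the direct limit. -/
theorem finrank_freelySymmetrized_zeroPad {F : Construction} {d r : ℕ} {n₀ : ℕ+}
    (hn₀ : bound F d ≤ n₀) (hr : ∀ n, n₀ ≤ n → Module.finrank ℝ (Inv F d n) = r) :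
    r ≤ Module.finrank ℝ (FreelySymmetrized F d .zeroPad) := by
  rw [← hr n₀ le_rfl]
  refine LinearMap.finrank_le_finrank_of_injective (f := toLim F d .zeroPad n₀) ?_
  rw [injective_iff_map_eq_zero]
  intro q hq
  obtain ⟨N, hN, h⟩ := exists_symMap_eq_zero hq
  refine (LinearMap.injective_iff_surjective_of_finrank_eq_finrank ?_).2
    (symMap_zeroPad_surjective hn₀ hN) (h.trans (map_zero _).symm)
  rw [hr n₀ le_rfl, hr N hN]

theorem finrank_freelyDescribed_zeroPad {F : Construction} {d r : ℕ} {n₀ : ℕ+}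
    (hn₀ : bound F d ≤ n₀) (hr : ∀ n, n₀ ≤ n → Module.finrank ℝ (Inv F d n) = r) :
    r ≤ Module.finrank ℝ (FreelyDescribed F d .zeroPad) := by
  have hn : ∀ m : ℕ+, n₀ ≤ m + n₀ := fun m => (PNat.lt_add_left n₀ m).le
  have hm : ∀ m : ℕ+, m ≤ m + n₀ := fun m => (PNat.lt_add_right m n₀).le
  -- An invariant polynomial in dimension `n₀` extends uniquely to all larger dimensions.
  have hsurj : Function.Surjective (proj F d .zeroPad n₀) := by
    intro q
    have hbij : ∀ {m}, ∀ h : n₀ ≤ m, Function.Surjective (restr F d h) := fun {m} h =>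
      (LinearMap.injective_iff_surjective_of_finrank_eq_finrank (by rw [hr m h, hr n₀ le_rfl])).1
        (restr_injective hn₀ h)
    choose ext hext using fun m => hbij (hn m) q
    refine ⟨⟨fun m => restr F d (hm m) (ext m), fun m M h x => ?_⟩, Subtype.ext ?_⟩
    · change (restr F d (hm M) (ext M)).1 (emb F .zeroPad h x) = (restr F d (hm m) (ext m)).1 x
      have h' : m + n₀ ≤ M + n₀ := add_le_add_left (α := ℕ+) h n₀
      have h1 : restr F d h' (ext M) = ext m :=
        restr_injective hn₀ (hn m) (by rw [restr_restr, hext, hext])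
      rw [← h1, restr_restr, ← restr_restr (show m ≤ M from h) (hm M)]
      rfl
    · exact congrArg Subtype.val (hext n₀)
  rw [← hr n₀ le_rfl]
  exact LinearMap.finrank_le_finrank_of_surjective hsurj

/-! ### Sampling with and without replacement -/

open Filter Topology

/-- A uniformly random map from a set with `k` elements to a set with `n` elements is injective
with probability tending to one. -/
theorem tendsto_injective_fraction (k : ℕ) : Tendsto (fun n : ℕ+ =>
    (Fintype.card (Fin k → Fin n) : ℝ)⁻¹ *
      (Finset.univ.filter fun f : Fin k → Fin n => f.Injective).card) atTop (𝓝 1) := by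
  have hcard : ∀ n : ℕ+, (Finset.univ.filter fun f : Fin k → Fin n => f.Injective).card =
      (n : ℕ).descFactorial k := fun n => by
    rw [← Fintype.card_subtype, Fintype.card_congr (Equiv.subtypeInjectiveEquivEmbedding _ _),
      Fintype.card_embedding_eq]
    simp
  have hcast : Tendsto (fun n : ℕ+ => ((n : ℕ) : ℝ)) atTop atTop :=
    tendsto_natCast_atTop_atTop.comp tendsto_PNat_val_atTop_atTop
  have hlow : Tendsto (fun n : ℕ+ => (1 - (k : ℝ) / ((n : ℕ) : ℝ)) ^ k) atTop (𝓝 1) := by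
    have h1 := ((tendsto_const_nhds (x := (1 : ℝ))).sub
      ((tendsto_const_nhds (x := (k : ℝ))).div_atTop hcast)).pow k
    simpa using h1
  refine tendsto_of_tendsto_of_tendsto_of_le_of_le' hlow tendsto_const_nhds ?_ ?_
  · filter_upwards [eventually_ge_atTop (⟨k + 1, Nat.succ_pos k⟩ : ℕ+)] with n hn
    have hn : k + 1 ≤ (n : ℕ) := hn
    have hn0 : (0 : ℝ) < (n : ℕ) := Nat.cast_pos.2 n.pos
    rw [hcard]
    have h1 : ((((n : ℕ) + 1 - k : ℕ) : ℝ)) ^ k ≤ ((n : ℕ).descFactorial k : ℝ) := by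
      exact_mod_cast Nat.pow_sub_le_descFactorial n k
    have h2 : (n : ℕ) - (k : ℝ) ≤ (((n : ℕ) + 1 - k : ℕ) : ℝ) := by
      rw [Nat.cast_sub (by omega)]
      push_cast
      linarith
    have h3 : (0 : ℝ) ≤ (n : ℕ) - (k : ℝ) := sub_nonneg.2 (Nat.cast_le.2 (by omega))
    have h4 : (1 - (k : ℝ) / (n : ℕ)) = ((n : ℕ) : ℝ)⁻¹ * ((n : ℕ) - k) := by
      field_simp
    rw [h4, mul_pow]
    simp only [Fintype.card_pi, Fintype.card_fin, Finset.prod_const, Finset.card_univ,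
      Nat.cast_pow, inv_pow]
    gcongr
    exact (pow_le_pow_left₀ h3 h2 k).trans h1
  · refine Eventually.of_forall fun n => ?_
    have : Nonempty (Fin n) := ⟨⟨0, n.pos⟩⟩
    refine inv_mul_le_one_of_le₀ ?_ (Nat.cast_nonneg _)
    exact_mod_cast Finset.card_le_univ _

/-- The averages over all maps `f` of a quantity that takes finitely many values, and the same
value for all injective `f`, converge to the latter. -/
theorem tendsto_average_of_injective {X : Type} [AddCommGroup X] [Module ℝ X] [TopologicalSpace X]
    [ContinuousAdd X] [ContinuousSMul ℝ X] {k : ℕ} (y : ∀ n : ℕ+, (Fin k → Fin n) → X)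
    {W : Set X} (hWfin : W.Finite) {y₀ : X} {n₀ : ℕ+}
    (hy : ∀ n, n₀ ≤ n → ∀ f, f.Injective → y n f = y₀)
    (hW : ∀ n, n₀ ≤ n → ∀ f, y n f ∈ W) :
    Tendsto (fun n : ℕ+ => (Fintype.card (Fin k → Fin n) : ℝ)⁻¹ • ∑ f, y n f)
      atTop (𝓝 y₀) := by
  classical
  let W' : Finset X := insert y₀ hWfin.toFinset
  let c : X → ℕ+ → ℝ := fun w n => (Fintype.card (Fin k → Fin n) : ℝ)⁻¹ *
    (Finset.univ.filter fun f => y n f = w).card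
  have hpos : ∀ n : ℕ+, 0 < (Fintype.card (Fin k → Fin n) : ℝ) := fun n => by
    have : Nonempty (Fin n) := ⟨⟨0, n.pos⟩⟩
    exact Nat.cast_pos.2 Fintype.card_pos
  have hc0 : ∀ w n, 0 ≤ c w n := fun w n =>
    mul_nonneg (inv_nonneg.2 (hpos n).le) (Nat.cast_nonneg _)
  have hc1 : ∀ w n, c w n ≤ 1 := fun w n => by
    refine inv_mul_le_one_of_le₀ ?_ (Nat.cast_nonneg _)
    exact_mod_cast Finset.card_le_univ _
  have hcy : Tendsto (c y₀) atTop (𝓝 1) := by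
    refine tendsto_of_tendsto_of_tendsto_of_le_of_le' (tendsto_injective_fraction k)
      tendsto_const_nhds ?_ (Eventually.of_forall (hc1 y₀))
    filter_upwards [eventually_ge_atTop n₀] with n hn
    refine mul_le_mul_of_nonneg_left (Nat.cast_le.2 (Finset.card_le_card fun f hf => ?_))
      (inv_nonneg.2 (hpos n).le)
    exact Finset.mem_filter.2 ⟨Finset.mem_univ f, hy n hn f (Finset.mem_filter.1 hf).2⟩
  have hcw : ∀ w, w ≠ y₀ → Tendsto (c w) atTop (𝓝 0) := fun w hw => by
    have h1 : Tendsto (fun n => 1 - c y₀ n) atTop (𝓝 0) := by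
      simpa using (tendsto_const_nhds (x := (1 : ℝ))).sub hcy
    refine squeeze_zero (hc0 w) (fun n => ?_) h1
    rw [le_sub_iff_add_le, ← mul_add, ← Nat.cast_add, ← Finset.card_union_of_disjoint]
    · refine inv_mul_le_one_of_le₀ ?_ (Nat.cast_nonneg _)
      exact_mod_cast Finset.card_le_univ _
    · exact Finset.disjoint_filter.2 fun f _ h1 h2 => hw (h1.symm.trans h2)
  have hlim : Tendsto (fun n => ∑ w ∈ W', c w n • w) atTop
      (𝓝 (∑ w ∈ W', (if w = y₀ then (1 : ℝ) else 0) • w)) := by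
    refine tendsto_finsetSum _ fun w _ => Tendsto.smul_const ?_ w
    split_ifs with h
    exacts [h ▸ hcy, hcw w h]
  have hy₀ : ∑ w ∈ W', (if w = y₀ then (1 : ℝ) else 0) • w = y₀ := by
    simp [W']
  rw [hy₀] at hlim
  refine hlim.congr' ?_
  filter_upwards [eventually_ge_atTop n₀] with n hn
  rw [← Finset.sum_fiberwise_of_maps_to (s := Finset.univ) (t := W') (g := y n) fun f _ =>
    Finset.mem_insert_of_mem (hWfin.mem_toFinset.2 (hW n hn f)), Finset.smul_sum]
  refine Finset.sum_congr rfl fun w _ => ?_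
  rw [Finset.sum_congr rfl fun f hf => (Finset.mem_filter.1 hf).2, Finset.sum_const, mul_smul,
    Nat.cast_smul_eq_nsmul]

/-! ### The topologies -/

instance (F : Construction) (d : ℕ) (κ : Kind) : IsModuleTopology ℝ (FreelySymmetrized F d κ) :=
  ⟨rfl⟩

instance (F : Construction) (d : ℕ) (κ : Kind) : ContinuousSMul ℝ (FreelySymmetrized F d κ) :=
  IsModuleTopology.toContinuousSMul ℝ _

instance (F : Construction) (d : ℕ) (κ : Kind) : ContinuousAdd (FreelySymmetrized F d κ) :=
  IsModuleTopology.toContinuousAdd ℝ _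

instance (F : Construction) (d : ℕ) (κ : Kind) : IsTopologicalAddGroup (FreelySymmetrized F d κ) :=
  IsModuleTopology.topologicalAddGroup ℝ _

instance (F : Construction) (d : ℕ) (κ : Kind) : Module.Free ℝ (FreelySymmetrized F d κ) :=
  Module.Free.of_divisionRing ℝ (FreelySymmetrized F d κ)

instance (F : Construction) (d : ℕ) (κ : Kind) : T2Space (FreelySymmetrized F d κ) :=
  let e := (Module.finBasis ℝ (FreelySymmetrized F d κ)).equivFun
  T2Space.of_injective_continuous e.injective
    (IsModuleTopology.continuous_of_linearMap e.toLinearMap)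

instance (F : Construction) (d : ℕ) (κ : Kind) : IsTopologicalAddGroup (FreelyDescribed F d κ) :=
  Submodule.topologicalAddGroup _

instance (F : Construction) (d : ℕ) (κ : Kind) : ContinuousAdd (FreelyDescribed F d κ) :=
  have h : IsTopologicalAddGroup (FreelyDescribed F d κ) := inferInstance
  ⟨h.continuous_add⟩

theorem continuous_limMap (F : Construction) (d : ℕ) (κ : Kind) : Continuous (limMap F d κ) :=
  IsModuleTopology.continuous_of_linearMap (limMap F d κ)

theorem continuous_eval_freelyDescribed {F : Construction} {d : ℕ} {κ : Kind} (n : ℕ+)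
    (x : Space F n) : Continuous fun p : FreelyDescribed F d κ => (p.1 n).1 x :=
  (continuous_apply x).comp (continuous_subtype_val.comp
    ((continuous_apply n).comp continuous_subtype_val))

theorem tendsto_freelyDescribed {F : Construction} {d : ℕ} {κ : Kind} {ι : Type} {l : Filter ι}
    {u : ι → FreelyDescribed F d κ} {p : FreelyDescribed F d κ}
    (h : ∀ n x, Tendsto (fun i => ((u i).1 n).1 x) l (𝓝 ((p.1 n).1 x))) : Tendsto u l (𝓝 p) :=
  tendsto_subtype_rng.2 (tendsto_pi_nhds.2 fun n => tendsto_subtype_rng.2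
    (tendsto_pi_nhds.2 fun x => h n x))

/-! ### The isomorphism between the limits -/

/-- The means of `q` over maps to `n` elements, seen in the direct limit over zero-padding, converge
to the class of `q`: a map that factors through a self-map `π` of `[k]` and an injection
contributes the class of `q ∘ ρ(π)`, and `π` may be taken to be the identity with probability
tending to one. -/
theorem tendsto_toLim_meanMap {F : Construction} {d : ℕ} {k : ℕ+} (q : Inv F d k) :
    Tendsto (fun n => toLim F d .zeroPad n ((meanMap F d .dup k q).1 n)) atTop
      (𝓝 (toLim F d .zeroPad k q)) := by
  let c : (Fin k → Fin k) → FreelySymmetrized F d .zeroPad := fun π => toLim F d .zeroPad k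
    (symInv F d k ⟨fun x => q.1 (pull F π x), poly_comp_pull π q.2.1⟩)
  let y : ∀ n : ℕ+, (Fin k → Fin n) → FreelySymmetrized F d .zeroPad := fun n f =>
    toLim F d .zeroPad n (symInv F d n ⟨fun x => q.1 (pull F f x), poly_comp_pull f q.2.1⟩)
  have hy : ∀ (n : ℕ+), k ≤ n → ∀ (π : Fin k → Fin k) (g : Fin k → Fin n), g.Injective →
      y n (g ∘ π) = c π := fun n hn π g hg => by
    refine Eq.trans ?_ (toLim_symMap (κ := .zeroPad) (N := n) hn _)
    refine congrArg (toLim F d .zeroPad n) ?_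
    refine Eq.trans ?_ (symInv_comp_pull (N := n) hn hg _)
    refine congrArg (symInv F d n) (Subtype.ext (funext fun x => ?_))
    exact (congrArg q.1 (pull_pull F π g x)).symm
  have hc : c _root_.id = toLim F d .zeroPad k q := by
    refine congrArg (toLim F d .zeroPad k) ((congrArg (symInv F d k) ?_).trans (symInv_of_inv q))
    exact Subtype.ext (funext fun x => congrArg q.1 (pull_id F x))
  have hlim := tendsto_average_of_injective y (Set.finite_range c) (n₀ := k)
    (fun n hn f hf => hy n hn _root_.id f hf) fun n hn f => by
      obtain ⟨g, π, hg, rfl⟩ := exists_eq_injective_comp (k := k) (n := n) hn f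
      exact ⟨π, (hy n hn π g hg).symm⟩
  rw [hc] at hlim
  refine hlim.congr fun n => ?_
  simp only [y]
  rw [← map_sum, ← map_sum, ← map_smul, ← map_smul]
  refine congrArg (toLim F d .zeroPad n) (Eq.trans ?_ (symInv_of_inv _))
  refine congrArg (symInv F d n) (Subtype.ext (funext fun x => ?_))
  simp [meanMap_apply, deFinettiMean]

/-- For a freely-described polynomial over zero-padding, the means of its terms converge to it:
an injection contributes the right value. -/
theorem tendsto_meanMap_zeroPad {F : Construction} {d : ℕ} (p : FreelyDescribed F d .zeroPad) :
    Tendsto (fun n => meanMap F d .zeroPad n (p.1 n)) atTop (𝓝 p) := by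
  refine tendsto_freelyDescribed fun r x => ?_
  let c : (Fin r → Fin r) → ℝ := fun π => (p.1 r).1 (push F π x)
  let y : ∀ n : ℕ+, (Fin r → Fin n) → ℝ := fun n f => (p.1 n).1 (push F f x)
  have hy : ∀ (n : ℕ+), r ≤ n → ∀ (π : Fin r → Fin r) (g : Fin r → Fin n), g.Injective →
      y n (g ∘ π) = c π := fun n hn π g hg => by
    have h1 := p.2 r n hn (push F π x)
    simp only [y, c]
    rw [← push_push, ← h1]
    exact inv_apply_push_injective _ hg (incl_injective hn) _
  have hc : c _root_.id = (p.1 r).1 x := congrArg (p.1 r).1 (push_id F x)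
  have hlim := tendsto_average_of_injective y (Set.finite_range c) (n₀ := r)
    (fun n hn f hf => hy n hn _root_.id f hf) fun n hn f => by
      obtain ⟨g, π, hg, rfl⟩ := exists_eq_injective_comp (k := r) (n := n) hn f
      exact ⟨π, (hy n hn π g hg).symm⟩
  rw [hc] at hlim
  exact hlim

/-- Over zero-padding `limMap` has dense range, over duplication it is injective; the dimensions give
the rest. -/
theorem limMap_bijective (F : Construction) (d : ℕ) (κ : Kind) :
    Function.Bijective (limMap F d κ) := by
  obtain ⟨n₀, hn₀, hr⟩ := exists_finrank_inv_eq F d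
  cases κ with
  | zeroPad =>
    have hsurj : Function.Surjective (limMap F d .zeroPad) := by
      intro p
      have hclosed : IsClosed (LinearMap.range (limMap F d .zeroPad) :
        Set (FreelyDescribed F d .zeroPad)) :=
        Submodule.closed_of_finiteDimensional (E := FreelyDescribed F d .zeroPad) (𝕜 := ℝ) _
      exact hclosed.mem_of_tendsto (tendsto_meanMap_zeroPad p)
        (Eventually.of_forall fun n => ⟨_, limMap_toLim n (p.1 n)⟩)
    have h1 := Module.finrank_le_of_rank_le (rank_freelySymmetrized_le (F := F) Kind.zeroPad.other hr)
    have h2 := finrank_freelyDescribed_zeroPad hn₀ hr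
    have h3 := LinearMap.finrank_le_finrank_of_surjective hsurj
    exact ⟨(LinearMap.injective_iff_surjective_of_finrank_eq_finrank
      (V := FreelySymmetrized F d Kind.zeroPad.other) (V₂ := FreelyDescribed F d .zeroPad)
      (le_antisymm (h1.trans h2) h3)).2 hsurj, hsurj⟩
  | dup =>
    have hinj : Function.Injective (limMap F d .dup) := by
      rw [injective_iff_map_eq_zero]
      intro u hu
      obtain ⟨k, q, rfl⟩ := exists_toLim_eq u
      have h1 := tendsto_toLim_meanMap q
      rw [limMap_toLim] at hu
      simp only [hu, ZeroMemClass.coe_zero, Pi.zero_apply, map_zero] at h1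
      have h2 : toLim F d .zeroPad k q = 0 := tendsto_nhds_unique h1 tendsto_const_nhds
      exact h2
    have h1 := Module.finrank_le_of_rank_le (rank_freelyDescribed_le (F := F) .dup hr)
    have h2 : _ ≤ Module.finrank ℝ (FreelySymmetrized F d Kind.dup.other) :=
      finrank_freelySymmetrized_zeroPad hn₀ hr
    have h3 := LinearMap.finrank_le_finrank_of_injective hinj
    exact ⟨hinj, (LinearMap.injective_iff_surjective_of_finrank_eq_finrank
      (V := FreelySymmetrized F d Kind.dup.other) (V₂ := FreelyDescribed F d .dup)
      (le_antisymm h3 (h1.trans h2))).1 hinj⟩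

/-- The terms of a freely-described polynomial approximate it. -/
theorem tendsto_limMap_toLim {F : Construction} {d : ℕ} {κ : Kind} (p : FreelyDescribed F d κ) :
    Tendsto (fun n => limMap F d κ (toLim F d κ.other n (p.1 n))) atTop (𝓝 p) := by
  cases κ with
  | zeroPad =>
    simp only [limMap_toLim]
    exact tendsto_meanMap_zeroPad p
  | dup =>
    obtain ⟨u, rfl⟩ := (limMap_bijective F d .dup).2 p
    obtain ⟨k, q, rfl⟩ := exists_toLim_eq u
    rw [limMap_toLim]
    have h1 := (continuous_limMap F d .dup).tendsto (toLim F d Kind.dup.other k q)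
    rw [limMap_toLim] at h1
    have h2 : Tendsto (fun n => toLim F d Kind.dup.other n ((meanMap F d .dup k q).1 n)) atTop
        (𝓝 (toLim F d Kind.dup.other k q)) := tendsto_toLim_meanMap q
    exact h1.comp h2

/-! ### Compatible sets -/

theorem FSCompatible.pull_mem {F : Construction} {Ω : ∀ n : ℕ+, Set (Space F n)}
    (hΩ : FSCompatible F .dup Ω) {k n : ℕ+} (f : Fin k → Fin n) {x : Space F n} (hx : x ∈ Ω n) :
    pull F f x ∈ Ω k := by
  obtain ⟨N, h, h', σ, rfl⟩ := exists_eq_equipart_comp f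
  have h1 := hΩ.embAdj_mem k N h _ (hΩ.act_mem N σ.symm _ (hΩ.emb_mem n N h' x hx))
  rw [← pull_pull, ← pull_pull]
  exact h1

theorem FSCompatible.push_mem {F : Construction} {Ω : ∀ n : ℕ+, Set (Space F n)}
    (hΩ : FSCompatible F .zeroPad Ω) {k n : ℕ+} (f : Fin n → Fin k) {x : Space F n}
    (hx : x ∈ Ω n) : push F f x ∈ Ω k := by
  obtain ⟨N, h, h', σ, rfl⟩ := exists_eq_equipart_comp f
  have h1 := hΩ.embAdj_mem k N h' _ (hΩ.act_mem N σ _ (hΩ.emb_mem n N h x hx))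
  rw [act_eq_push] at h1
  rw [← push_push, ← push_push]
  exact h1

theorem FSCompatible.deFinettiMean_nonneg {F : Construction} {κ : Kind}
    {Ω : ∀ n : ℕ+, Set (Space F n)} (hΩ : FSCompatible F κ Ω) {k : ℕ+} {q : Space F k → ℝ}
    (hq : ∀ x ∈ Ω k, 0 ≤ q x) {n : ℕ+} {x : Space F n} (hx : x ∈ Ω n) :
    0 ≤ deFinettiMean F κ q n x := by
  cases κ with
  | zeroPad =>
    exact mul_nonneg (inv_nonneg.2 (Nat.cast_nonneg _))
      (Finset.sum_nonneg fun f _ => hq _ (hΩ.push_mem f hx))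
  | dup =>
    exact mul_nonneg (inv_nonneg.2 (Nat.cast_nonneg _))
      (Finset.sum_nonneg fun f _ => hq _ (hΩ.pull_mem f hx))

theorem FSCompatible.symMap_nonneg {F : Construction} {d : ℕ} {κ : Kind}
    {Ω : ∀ n : ℕ+, Set (Space F n)} (hΩ : FSCompatible F κ Ω) {n N : ℕ+} (h : κ.other.le n N)
    {q : Inv F d n} (hq : ∀ x ∈ Ω n, 0 ≤ q.1 x) {x : Space F N} (hx : x ∈ Ω N) :
    0 ≤ (symMap F d κ.other h q).1 x :=
  mul_nonneg (inv_nonneg.2 (Nat.cast_nonneg _)) (Finset.sum_nonneg fun σ _ =>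
    hq _ (hΩ.embAdj_mem n N h _ (hΩ.act_mem N σ x hx)))

/-! ### The cone in the direct limit -/

section Cone

variable {F : Construction} {d : ℕ} {κ : Kind} {Ω : ∀ n : ℕ+, Set (Space F n)}

theorem symmetrizedCone_add (hΩ : FSCompatible F κ Ω) {u v : FreelySymmetrized F d κ.other}
    (hu : u ∈ symmetrizedCone d κ.other Ω) (hv : v ∈ symmetrizedCone d κ.other Ω) :
    u + v ∈ symmetrizedCone d κ.other Ω := by
  obtain ⟨k, q, hq, rfl⟩ := hu
  obtain ⟨l, r, hr, rfl⟩ := hv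
  have hk : κ.other.le k (k * l) := κ.other.le_of_dvd (dvd_mul_right _ _)
  have hl : κ.other.le l (k * l) := κ.other.le_of_dvd (dvd_mul_left _ _)
  refine ⟨k * l, symMap F d κ.other hk q + symMap F d κ.other hl r, fun x hx =>
    add_nonneg (hΩ.symMap_nonneg hk hq hx) (hΩ.symMap_nonneg hl hr hx), ?_⟩
  rw [map_add, toLim_symMap, toLim_symMap]

theorem symmetrizedCone_smul {c : ℝ} (hc : 0 ≤ c) {u : FreelySymmetrized F d κ}
    (hu : u ∈ symmetrizedCone d κ Ω) : c • u ∈ symmetrizedCone d κ Ω := by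
  obtain ⟨k, q, hq, rfl⟩ := hu
  exact ⟨k, c • q, fun x hx => mul_nonneg hc (hq x hx), (map_smul _ c q).symm⟩

theorem toLim_mem_symmetrizedCone {k : ℕ+} {q : Inv F d k} (hq : ∀ x ∈ Ω k, 0 ≤ q.1 x) :
    toLim F d κ k q ∈ symmetrizedCone d κ Ω := ⟨k, q, hq, rfl⟩

/-- Compatible sets are preserved by the random maps `L_{k,n}`. -/
theorem limMap_mem_describedCone (hΩ : FSCompatible F κ Ω) {u : FreelySymmetrized F d κ.other}
    (hu : u ∈ symmetrizedCone d κ.other Ω) : limMap F d κ u ∈ describedCone d κ Ω := by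
  obtain ⟨k, q, hq, rfl⟩ := hu
  intro n x hx
  rw [limMap_toLim]
  exact hΩ.deFinettiMean_nonneg hq hx

/-- If `u` and `-u` are represented by nonnegative polynomials, then these two sum to zero in a
high enough common dimension, where both must vanish on the set. -/
theorem symmetrizedCone_inter_neg (hΩ : FSCompatible F κ Ω) :
    symmetrizedCone d κ.other Ω ∩ -symmetrizedCone d κ.other Ω =
      {u | ∃ (k : ℕ+) (q : Inv F d k), (∀ x ∈ Ω k, q.1 x = 0) ∧
        u = toLim F d κ.other k q} := by
  ext u
  refine ⟨?_, ?_⟩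
  · rintro ⟨⟨k, q, hq, hu⟩, ⟨l, r, hr, hu'⟩⟩
    have hk : κ.other.le k (k * l) := κ.other.le_of_dvd (dvd_mul_right _ _)
    have hl : κ.other.le l (k * l) := κ.other.le_of_dvd (dvd_mul_left _ _)
    have h0 : toLim F d κ.other (k * l)
        (symMap F d κ.other hk q + symMap F d κ.other hl r) = 0 := by
      rw [map_add, toLim_symMap, toLim_symMap, ← hu, ← hu']
      exact add_neg_cancel u
    obtain ⟨N, hN, h1⟩ := exists_symMap_eq_zero h0
    refine ⟨N, symMap F d κ.other hN (symMap F d κ.other hk q), fun x hx => ?_, ?_⟩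
    · have h2 := hΩ.symMap_nonneg hN (fun y hy => hΩ.symMap_nonneg hk hq hy) hx
      have h3 := hΩ.symMap_nonneg hN (fun y hy => hΩ.symMap_nonneg hl hr hy) hx
      have h4 : (symMap F d κ.other hN (symMap F d κ.other hk q)).1 x +
          (symMap F d κ.other hN (symMap F d κ.other hl r)).1 x = 0 := by
        rw [map_add] at h1
        exact congrFun (congrArg Subtype.val h1) x
      linarith
    · rw [toLim_symMap, toLim_symMap, hu]
  · rintro ⟨k, q, hq, rfl⟩
    refine ⟨⟨k, q, fun x hx => (hq x hx).ge, rfl⟩, ⟨k, -q, fun x hx => ?_, (map_neg _ q).symm⟩⟩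
    exact (neg_eq_zero.2 (hq x hx)).ge

theorem describedCone_inter_neg : describedCone d κ Ω ∩ -describedCone d κ Ω =
    {p | ∀ n : ℕ+, ∀ x ∈ Ω n, (p.1 n).1 x = 0} := by
  ext p
  refine ⟨fun h n x hx => le_antisymm (neg_nonneg.1 (h.2 n x hx)) (h.1 n x hx), fun h =>
    ⟨fun n x hx => (h n x hx).ge, fun n x hx => (neg_eq_zero.2 (h n x hx)).ge⟩⟩

theorem isClosed_describedCone : IsClosed (describedCone d κ Ω) := by
  have h : describedCone d κ Ω = ⋂ (n : ℕ+) (x ∈ Ω n), {p | 0 ≤ (p.1 n).1 x} := by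
    ext p
    simp [describedCone]
  rw [h]
  exact isClosed_iInter fun n => isClosed_biInter fun x _ =>
    isClosed_le continuous_const (continuous_eval_freelyDescribed n x)

/-! ### Interiors -/

/-- A convex cone that generates a finite-dimensional space has interior points, such as the sum of
the elements of the cone needed for generating a basis. -/
theorem interior_nonempty_of_generating {X : Type} [AddCommGroup X] [Module ℝ X]
    [TopologicalSpace X] [IsTopologicalAddGroup X] [ContinuousSMul ℝ X] [T2Space X]
    [FiniteDimensional ℝ X] {K : Set X} (hadd : ∀ u ∈ K, ∀ v ∈ K, u + v ∈ K)
    (hsmul : ∀ c : ℝ, 0 ≤ c → ∀ u ∈ K, c • u ∈ K)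
    (hgen : ∀ x : X, ∃ u ∈ K, ∃ v ∈ K, x = u - v) : (interior K).Nonempty := by
  let b := Module.finBasis ℝ X
  choose u hu v hv huv using fun i => hgen (b i)
  have hzero : (0 : X) ∈ K := by
    obtain ⟨w, hw, -⟩ := hgen 0
    simpa using hsmul 0 le_rfl w hw
  have hsum : ∀ (s : Finset (Fin (Module.finrank ℝ X))) (w : Fin (Module.finrank ℝ X) → X),
      (∀ i, w i ∈ K) → ∑ i ∈ s, w i ∈ K := fun s w hw =>
    Finset.sum_induction w (· ∈ K) (fun _ _ h h' => hadd _ h _ h') hzero fun i _ => hw i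
  let c : X := ∑ i, (u i + v i)
  let U : Set X := {x | ∀ i, |b.coord i (x - c)| < 1}
  have hU : IsOpen U := by
    have h1 : U = ⋂ i, {x | |b.coord i (x - c)| < 1} := by
      ext x
      simp [U]
    rw [h1]
    refine isOpen_iInter_of_finite fun i => isOpen_lt ?_ continuous_const
    exact ((b.coord i).continuous_of_finiteDimensional.comp
      (continuous_id.sub continuous_const)).abs
  refine ⟨c, interior_maximal (fun x hx => ?_) hU (fun i => by simp)⟩
  have h1 : x = ∑ i, ((1 + b.coord i (x - c)) • u i + (1 - b.coord i (x - c)) • v i) := by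
    have h2 : x - c = ∑ i, b.coord i (x - c) • b i := (b.sum_repr (x - c)).symm
    calc x = c + (x - c) := by abel
      _ = ∑ i, (u i + v i) + ∑ i, b.coord i (x - c) • b i := by rw [← h2]
      _ = _ := by
        rw [← Finset.sum_add_distrib]
        refine Finset.sum_congr rfl fun i _ => ?_
        generalize b.coord i (x - c) = t
        rw [huv i]
        module
  rw [h1]
  refine hsum _ _ fun i => ?_
  have h2 := abs_lt.1 (hx i)
  exact hadd _ (hsmul _ (by linarith) _ (hu i)) _ (hsmul _ (by linarith) _ (hv i))

/-- The invariant polynomial `(1 + ‖x‖²)^c`. -/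
def sqInv (F : Construction) {d c : ℕ} (hc : c + c ≤ d) (n : ℕ+) : Inv F d n :=
  ⟨fun x => (1 + ∑ a, x.1 a ^ 2) ^ c, by
    refine ⟨⟨(1 + ∑ a, MvPolynomial.X a ^ 2) ^ c, ?_, fun x => by simp⟩, fun σ x => ?_⟩
    · refine (MvPolynomial.totalDegree_pow _ _).trans (le_trans ?_ ((mul_two c).le.trans hc))
      refine Nat.mul_le_mul_left _ ((MvPolynomial.totalDegree_add _ _).trans (max_le ?_ ?_))
      · simp
      · refine MvPolynomial.totalDegree_finsetSum_le fun a _ => ?_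
        exact (MvPolynomial.totalDegree_pow _ _).trans (by simp)
    · have hbij : (Idx.map F (σ.symm : Fin n → Fin n)).Bijective :=
        Finite.injective_iff_bijective.1 (Idx.map_injective F σ.symm.injective)
      change (1 + ∑ a, x.1 (Idx.map F σ.symm a) ^ 2) ^ c = _
      rw [hbij.sum_comp fun a => x.1 a ^ 2]⟩

theorem sqInv_apply {c : ℕ} (hc : c + c ≤ d) (n : ℕ+) (x : Space F n) :
    (sqInv F hc n).1 x = (1 + ∑ a, x.1 a ^ 2) ^ c := rfl

theorem exists_abs_le_sqInv {c : ℕ} (hc : c + c = d) {n : ℕ+} {q : Space F n → ℝ}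
    (hq : q ∈ Poly F d n) : ∃ C : ℝ, ∀ x, |q x| ≤ C * (sqInv F hc.le n).1 x := by
  obtain ⟨P, hP, hqP⟩ := hq
  refine ⟨∑ m ∈ P.support, |P.coeff m|, fun x => ?_⟩
  -- Each monomial is bounded by `(1 + ‖x‖²)^c`, which is seen by squaring.
  rw [hqP, MvPolynomial.eval_eq, Finset.sum_mul, sqInv_apply]
  refine (Finset.abs_sum_le_sum_abs _ _).trans (Finset.sum_le_sum fun m hm => ?_)
  rw [abs_mul]
  refine mul_le_mul_of_nonneg_left ?_ (abs_nonneg _)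
  have hs : ∀ b, x.1 b ^ 2 ≤ 1 + ∑ a, x.1 a ^ 2 := fun b =>
    (Finset.single_le_sum (f := fun a => x.1 a ^ 2) (fun a _ => sq_nonneg _)
      (Finset.mem_univ b)).trans (le_add_of_nonneg_left zero_le_one)
  have hs1 : 1 ≤ 1 + ∑ a, x.1 a ^ 2 :=
    le_add_of_nonneg_right (Finset.sum_nonneg fun a _ => sq_nonneg _)
  generalize 1 + ∑ a, x.1 a ^ 2 = s at hs hs1
  refine abs_le_of_sq_le_sq ?_ (pow_nonneg (zero_le_one.trans hs1) c)
  calc (∏ b ∈ m.support, x.1 b ^ m b) ^ 2 = ∏ b ∈ m.support, (x.1 b ^ 2) ^ m b := by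
        rw [← Finset.prod_pow]
        exact Finset.prod_congr rfl fun b _ => pow_right_comm _ _ _
    _ ≤ ∏ b ∈ m.support, s ^ m b := Finset.prod_le_prod
        (fun b _ => pow_nonneg (sq_nonneg _) _)
        fun b _ => pow_le_pow_left₀ (sq_nonneg _) (hs b) _
    _ = s ^ ∑ b ∈ m.support, m b := Finset.prod_pow_eq_pow_sum _ _ _
    _ ≤ s ^ (c * 2) := pow_le_pow_right₀ hs1
        (((MvPolynomial.le_totalDegree hm).trans hP).trans (by omega))
    _ = (s ^ c) ^ 2 := pow_mul _ _ _

theorem continuous_of_mem_poly {n : ℕ+} {q : Space F n → ℝ} (hq : q ∈ Poly F d n) :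
    Continuous q := by
  obtain ⟨P, -, hqP⟩ := hq
  rw [show q = fun x => MvPolynomial.eval x.1 P from funext hqP]
  exact (MvPolynomial.continuous_eval P).comp continuous_subtype_val

theorem exists_abs_le_inv (h : Even d ∨ ∀ n : ℕ+, Bornology.IsBounded (Ω n)) {n : ℕ+}
    (q : Inv F d n) : ∃ g : Inv F d n, ∀ x ∈ Ω n, |q.1 x| ≤ g.1 x := by
  rcases h with ⟨c, hc⟩ | h
  · obtain ⟨C, hC⟩ := exists_abs_le_sqInv hc.symm q.2.1
    exact ⟨C • sqInv F hc.symm.le n, fun x _ => hC x⟩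
  · obtain ⟨C, hC⟩ := (h n).isCompact_closure.exists_bound_of_continuousOn
      (continuous_of_mem_poly q.2.1).continuousOn
    refine ⟨C • sqInv F (c := 0) (Nat.zero_le d) n, fun x hx => ?_⟩
    refine (hC x (subset_closure hx)).trans (le_of_eq ?_)
    change C = C * _
    rw [sqInv_apply, pow_zero, mul_one]

theorem interior_symmetrizedCone_nonempty (hΩ : FSCompatible F κ Ω)
    (h : Even d ∨ ∀ n : ℕ+, Bornology.IsBounded (Ω n)) :
    (interior (symmetrizedCone d κ.other Ω)).Nonempty := by
  refine interior_nonempty_of_generating (X := FreelySymmetrized F d κ.other)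
    (fun u hu v hv => symmetrizedCone_add hΩ hu hv)
    (fun c hc u hu => symmetrizedCone_smul hc hu) fun u => ?_
  obtain ⟨k, q, rfl⟩ := exists_toLim_eq u
  obtain ⟨g, hg⟩ := exists_abs_le_inv h q
  refine ⟨toLim F d κ.other k (q + g), toLim_mem_symmetrizedCone fun x hx => ?_,
    toLim F d κ.other k g, toLim_mem_symmetrizedCone fun x hx => ?_, ?_⟩
  · exact neg_le_iff_add_nonneg.1 (abs_le.1 (hg x hx)).1
  · exact (abs_nonneg _).trans (hg x hx)
  · rw [map_add]
    exact (add_sub_cancel_right (G := FreelySymmetrized F d κ.other) _ _).symm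

theorem interior_describedCone_nonempty (hΩ : FSCompatible F κ Ω)
    (h : Even d ∨ ∀ n : ℕ+, Bornology.IsBounded (Ω n)) :
    (interior (describedCone d κ Ω)).Nonempty := by
  obtain ⟨u, hu⟩ := interior_symmetrizedCone_nonempty (d := d) hΩ h
  let e := LinearEquiv.ofBijective (limMap F d κ) (limMap_bijective F d κ)
  have hcont : Continuous e.symm :=
    LinearMap.continuous_of_finiteDimensional (E := FreelyDescribed F d κ)
      (F' := FreelySymmetrized F d κ.other) e.symm.toLinearMap
  refine ⟨e u, interior_maximal (fun p hp => ?_)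
    (isOpen_interior.preimage hcont :
      IsOpen (e.symm ⁻¹' interior (symmetrizedCone d κ.other Ω))) ?_⟩
  · rw [← e.apply_symm_apply p]
    exact limMap_mem_describedCone hΩ (interior_subset hp)
  · rw [Set.mem_preimage, e.symm_apply_apply]
    exact hu

end Cone

end FreePoly

end

open FreePoly

theorem mainTheorem8 (F : FreePoly.Construction) (κ : FreePoly.Kind) (d : ℕ)
    (Ω : ∀ n : ℕ+, Set (FreePoly.Space F n)) (hΩ : FreePoly.FSCompatible F κ Ω) :
    -- the ambient spaces are finite-dimensional
    FiniteDimensional ℝ (FreePoly.FreelyDescribed F d κ) ∧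
    FiniteDimensional ℝ (FreePoly.FreelySymmetrized F d κ.other) ∧
    -- density
    (∃ e : FreePoly.FreelySymmetrized F d κ.other ≃ₗ[ℝ] FreePoly.FreelyDescribed F d κ,
      (∀ (k : ℕ+) (q : FreePoly.Inv F d k) (n : ℕ+) (x : FreePoly.Space F n),
        ((e (FreePoly.toLim F d κ.other k q)).1 n).1 x = FreePoly.deFinettiMean F κ q.1 n x) ∧
      e '' FreePoly.symmetrizedCone d κ.other Ω ⊆ FreePoly.describedCone d κ Ω ∧
      FreePoly.describedCone d κ Ω ⊆ closure (e '' FreePoly.symmetrizedCone d κ.other Ω)) ∧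
    -- monotonicity
    (∀ n N : ℕ+, κ.le n N →
      FreePoly.proj F d κ N ⁻¹' FreePoly.nonnegCone d Ω N ⊆
        FreePoly.proj F d κ n ⁻¹' FreePoly.nonnegCone d Ω n) ∧
    (∀ n N : ℕ+, κ.other.le n N →
      FreePoly.toLim F d κ.other n '' FreePoly.nonnegCone d Ω n ⊆
        FreePoly.toLim F d κ.other N '' FreePoly.nonnegCone d Ω N) ∧
    FreePoly.describedCone d κ Ω =
      ⋂ n : ℕ+, FreePoly.proj F d κ n ⁻¹' FreePoly.nonnegCone d Ω n ∧
    FreePoly.symmetrizedCone d κ.other Ω =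
      ⋃ n : ℕ+, FreePoly.toLim F d κ.other n '' FreePoly.nonnegCone d Ω n ∧
    -- geometry: both sets are convex cones containing zero, and the first one is closed
    Convex ℝ (FreePoly.describedCone d κ Ω) ∧
    Convex ℝ (FreePoly.symmetrizedCone d κ.other Ω) ∧
    (∀ c : ℝ, 0 ≤ c → ∀ p ∈ FreePoly.describedCone d κ Ω, c • p ∈ FreePoly.describedCone d κ Ω) ∧
    (∀ c : ℝ, 0 ≤ c → ∀ u ∈ FreePoly.symmetrizedCone d κ.other Ω,
      c • u ∈ FreePoly.symmetrizedCone d κ.other Ω) ∧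
    0 ∈ FreePoly.describedCone d κ Ω ∧
    0 ∈ FreePoly.symmetrizedCone d κ.other Ω ∧
    IsClosed (FreePoly.describedCone d κ Ω) ∧
    -- geometry: the lineality spaces, and pointedness
    FreePoly.describedCone d κ Ω ∩ -FreePoly.describedCone d κ Ω =
      {p | ∀ n : ℕ+, ∀ x ∈ Ω n, (p.1 n).1 x = 0} ∧
    FreePoly.symmetrizedCone d κ.other Ω ∩ -FreePoly.symmetrizedCone d κ.other Ω =
      {u | ∃ (k : ℕ+) (q : FreePoly.Inv F d k), (∀ x ∈ Ω k, q.1 x = 0) ∧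
        u = FreePoly.toLim F d κ.other k q} ∧
    ((∀ (n : ℕ+) (q : FreePoly.Inv F d n), (∀ x ∈ Ω n, q.1 x = 0) → q = 0) →
      FreePoly.describedCone d κ Ω ∩ -FreePoly.describedCone d κ Ω = {0} ∧
      FreePoly.symmetrizedCone d κ.other Ω ∩ -FreePoly.symmetrizedCone d κ.other Ω = {0}) ∧
    -- geometry: interiors
    ((Even d ∨ ∀ n : ℕ+, Bornology.IsBounded (Ω n)) →
      (interior (FreePoly.describedCone d κ Ω)).Nonempty ∧
      (interior (FreePoly.symmetrizedCone d κ.other Ω)).Nonempty) := by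
  refine ⟨inferInstance, inferInstance,
    ⟨LinearEquiv.ofBijective (limMap F d κ) (limMap_bijective F d κ), fun k q n x => ?_, ?_, ?_⟩,
    fun n N h p hp x hx => ?_, ?_, ?_, ?_, ?_, ?_, ?_, ?_, ?_, ?_, isClosed_describedCone,
    describedCone_inter_neg, symmetrizedCone_inter_neg hΩ, fun h => ⟨?_, ?_⟩,
    fun h => ⟨interior_describedCone_nonempty hΩ h, interior_symmetrizedCone_nonempty hΩ h⟩⟩
  · rw [LinearEquiv.ofBijective_apply, limMap_toLim, meanMap_apply]
  · rintro _ ⟨u, hu, rfl⟩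
    exact limMap_mem_describedCone hΩ hu
  · intro p hp
    exact mem_closure_of_tendsto (tendsto_limMap_toLim p) (Filter.Eventually.of_forall fun n =>
      ⟨_, toLim_mem_symmetrizedCone (hp n), rfl⟩)
  · have h1 := p.2 n N h x
    exact (hp _ (hΩ.emb_mem n N h x hx)).trans_eq h1
  · rintro n N h _ ⟨q, hq, rfl⟩
    exact ⟨symMap F d κ.other h q, fun x hx => hΩ.symMap_nonneg h hq hx, toLim_symMap h q⟩
  · ext p
    simp only [Set.mem_iInter]
    rfl
  · ext u
    simp only [Set.mem_iUnion]
    exact ⟨fun ⟨k, q, hq, hu⟩ => ⟨k, q, hq, hu.symm⟩, fun ⟨k, q, hq, hu⟩ => ⟨k, q, hq, hu.symm⟩⟩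
  · exact fun p hp q hq a b ha hb _ n x hx =>
      add_nonneg (mul_nonneg ha (hp n x hx)) (mul_nonneg hb (hq n x hx))
  · exact fun u hu v hv a b ha hb _ =>
      symmetrizedCone_add hΩ (symmetrizedCone_smul ha hu) (symmetrizedCone_smul hb hv)
  · exact fun c hc p hp n x hx => mul_nonneg hc (hp n x hx)
  · exact fun c hc u hu => symmetrizedCone_smul hc hu
  · exact fun n x _ => le_rfl
  · exact ⟨1, 0, fun x _ => le_rfl, (map_zero _).symm⟩
  · rw [describedCone_inter_neg]
    ext p
    refine ⟨fun hp => Subtype.ext (funext fun n => h n _ (hp n)), ?_⟩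
    rintro rfl n x _
    rfl
  · rw [symmetrizedCone_inter_neg hΩ]
    ext u
    refine ⟨?_, ?_⟩
    · rintro ⟨k, q, hq, rfl⟩
      rw [h k q hq, map_zero]
      rfl
    · rintro rfl
      exact ⟨1, 0, fun x _ => rfl, (map_zero _).symm⟩
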